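/- Let $\mathcal D$ be a triangulated category whose Grothendieck group $K(\mathcal D)$ is free of finite rank, let $G$ be a split-generator of $\mathcal D$ (the smallest triangulated subcategory containing $G$ and closed under direct summands is $\mathcal D$), and let $F\colon\mathcal D\to\mathcal D$ be an exact endofunctor. Put $\log 0=-\infty$. For objects $E_1,E_2$ and $t\in\mathbb R$, let $\delta_t(E_1,E_2)\in[0,\infty]$ be the infimum of $\sum_{i=1}^k e^{n_it}$ over all sequences of exact triangles $X_{i-1}\to X_i\to E_1[n_i]\to X_{i-1}[1]$ $(1\le i\le k)$ with $X_0=0$ and $X_k\cong E_2\oplus E_2'$ for some object $E_2'$ (it is $0$ if $E_2\cong0$, and $\infty$ if there is no such sequence). The entropy of $F$ is $h_t(F)=\lim_{n\to\infty}\frac1n\log\delta_t(G,F^nG)$. A stability condition $\sigma=(Z,\mathcal P)$ on $\mathcal D$ consists of a homomorphism $Z\colon K(\mathcal D)\to\mathbb C$ and full additive subcategories $\mathcal P(\phi)\subset\mathcal D$, closed under isomorphism, $\phi\in\mathbb R$, such that: (a) if $0\ne E\in\mathcal P(\phi)$, then $Z(E)\in\mathbb R_{>0}\,e^{i\pi\phi}$;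 (b) $\mathcal P(\phi+1)=\mathcal P(\phi)[1]$; (c) $\mathrm{Hom}(A_1,A_2)=0$ if $A_i\in\mathcal P(\phi_i)$ and $\phi_1>\phi_2$; (d) every $E\ne0$ has a Harder-Narasimhan filtration, i.e. exact triangles $E_{i-1}\to E_i\to A_i\to E_{i-1}[1]$ $(1\le i\le m)$ with $E_0=0$, $E_m=E$, $0\ne A_i\in\mathcal P(\phi_i)$ and $\phi_1>\dots>\phi_m$; (e) (support property) for some norm on $K(\mathcal D)\otimes\mathbb R$ and some $C>0$, $|Z(E)|>C\|[E]\|$ for all $\phi$ and $0\ne E\in\mathcal P(\phi)$. In (d) put $\phi_\sigma^+(E)=\phi_1$, $\phi_\sigma^-(E)=\phi_m$ and $m_{\sigma,t}(E)=\sum_i|Z(A_i)|e^{\phi_it}$; also $m_{\sigma,t}(0)=0$. The mass growth of $F$ is $$h_{\sigma,t}(F)=\sup_{E\in\mathcal D}\ \limsup_{n\to\infty}\frac1n\log m_{\sigma,t}(F^nE)\in[-\infty,\infty].$$ The set $\mathrm{Stab}(\mathcal D)$ of stability conditions has the topology generated by the sets $B_\varepsilon(\sigma)$, $0<\varepsilon<\frac14$,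 where $B_\varepsilon(\sigma)$ consists of the $\tau=(W,\mathcal Q)$ with $$\sup_{E\ne0}\max\{|\phi_\sigma^-(E)-\phi_\tau^-(E)|,|\phi_\sigma^+(E)-\phi_\tau^+(E)|\}<\varepsilon,\qquad \sup_{\phi,\;0\ne E\in\mathcal P(\phi)}\frac{|Z(E)-W(E)|}{|Z(E)|}<\sin(\pi\varepsilon).$$ Call $\sigma$ algebraic if its heart, the abelian category $\mathcal P((0,1])$ of all $E$ that are zero or satisfy $\phi_\sigma^\pm(E)\in(0,1]$, is of finite length with finitely many isomorphism classes of simple objects. Theorem 3.16. Suppose a connected component $\mathrm{Stab}^\circ(\mathcal D)\subset\mathrm{Stab}(\mathcal D)$ contains an algebraic stability condition. Then for every $\sigma\in\mathrm{Stab}^\circ(\mathcal D)$ and every $t\in\mathbb R$, the limits below (including the one defining $h_t(F)$) exist in $[-\infty,\infty]$ and $$h_t(F)=h_{\sigma,t}(F)=\lim_{n\to\infty}\frac1n\log m_{\sigma,t}(F^nG).$$ -/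

import Mathlib

open CategoryTheory Limits Pretriangulated Filter Topology
open scoped ENNReal TensorProduct ZeroObject

universe v u

noncomputable section

namespace MassGrowth

variable (D : Type u) [Category.{v} D] [Preadditive D] [HasZeroObject D] [HasShift D ℤ]
  [∀ n : ℤ, (shiftFunctor D n).Additive] [Pretriangulated D]

/-! ### The Grothendieck group -/

/-- The subgroup of the free abelian group on the objects of `D` generated by the elements
`[Y] - [X] - [W]`, one for each exact triangle `X ⟶ Y ⟶ W ⟶ X⟦1⟧`. -/
def triangleRelations : AddSubgroup (FreeAbelianGroup D) :=
  AddSubgroup.closure {x | ∃ T ∈ distTriang D,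
    x = FreeAbelianGroup.of T.obj₂ - FreeAbelianGroup.of T.obj₁ - FreeAbelianGroup.of T.obj₃}

/-- The Grothendieck group `K(D)`. -/
abbrev K₀ : Type u := FreeAbelianGroup D ⧸ triangleRelations D

variable {D}

/-- The class `[E]` of an object in the Grothendieck group. -/
def K₀.cls (E : D) : K₀ D := QuotientAddGroup.mk (FreeAbelianGroup.of E)

/-! ### Towers of exact triangles -/

/-- There is a sequence of exact triangles `X i ⟶ X (i + 1) ⟶ A i ⟶ (X i)⟦1⟧`, `0 ≤ i < m`, with
`X 0` a zero object and `X m` isomorphic to `E`. -/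
def IsTower {m : ℕ} (A : Fin m → D) (E : D) : Prop :=
  ∃ X : Fin (m + 1) → D, IsZero (X 0) ∧ Nonempty (X (Fin.last m) ≅ E) ∧
    ∀ i : Fin m, ∃ (f : X i.castSucc ⟶ X i.succ) (g : X i.succ ⟶ A i)
      (h : A i ⟶ (X i.castSucc)⟦(1 : ℤ)⟧), Triangle.mk f g h ∈ distTriang D

/-! ### Complexity and entropy -/

/-- `G` is a split-generator: the smallest triangulated subcategory of `D` that contains `G` and
is closed under direct summands is `D` itself. -/
def IsSplitGenerator (G : D) : Prop :=
  (ObjectProperty.singleton G).IsClassicalTriangulatedGenerator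

/-- The complexity `δ_t(E₁, E₂) ∈ [0, ∞]`: the infimum of `∑ i, exp (n i * t)` over all sequences
of exact triangles which build `E₂ ⊞ E'`, for some object `E'`, from the shifts `E₁⟦n i⟧`. The empty
sequence gives the value `0` if `E₂` is a zero object (see `complexity_of_isZero`), and the infimum
of the empty set is `∞`, the value if `E₂` is not in the thick subcategory generated by `E₁`. -/
def complexity (t : ℝ) (E₁ E₂ : D) : ℝ≥0∞ :=
  sInf {x | ∃ (k : ℕ) (n : Fin k → ℤ) (E' : D),
    IsTower (fun i => E₁⟦n i⟧) (E₂ ⊞ E') ∧ x = ENNReal.ofReal (∑ i, Real.exp (n i * t))}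

theorem complexity_of_isZero (t : ℝ) (E₁ E₂ : D) (h : IsZero E₂) : complexity t E₁ E₂ = 0 := by
  refine le_antisymm (sInf_le ⟨0, Fin.elim0, 0, ⟨fun _ => 0, isZero_zero D, ⟨?_⟩, ?_⟩, by simp⟩)
    bot_le
  · exact (isZero_zero D).iso (by
      rw [IsZero.iff_id_eq_zero]
      ext <;> exact h.eq_of_src _ _)
  · exact fun i => i.elim0

/-- The sequence `(1 / n) * log δ_t(G, Fⁿ G)` in `[-∞, ∞]`, where `log 0 = -∞`. -/
def entropySeq (G : D) (F : D ⥤ D) (t : ℝ) (n : ℕ) : EReal :=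
  ENNReal.log (complexity t G (F.obj^[n] G)) / (n : EReal)

/-- The entropy `h_t(F) = lim (1 / n) * log δ_t(G, Fⁿ G)`, computed with the split-generator `G`. -/
def entropy (G : D) (F : D ⥤ D) (t : ℝ) : EReal :=
  limUnder atTop (entropySeq G F t)

/-! ### Stability conditions -/

/-- A Harder-Narasimhan filtration of `E` with respect to the subcategories `P φ`: nonzero factors
`A i` of phases `φ 0 > φ 1 > ⋯ > φ n`. -/
structure HNFiltration (P : ℝ → ObjectProperty D) (E : D) where
  /-- The number of factors is `n + 1`. -/
  n : ℕ
  /-- The phases. -/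
  φ : Fin (n + 1) → ℝ
  /-- The semistable factors. -/
  A : Fin (n + 1) → D
  φ_strictAnti : StrictAnti φ
  mem (i : Fin (n + 1)) : P (φ i) (A i)
  not_isZero (i : Fin (n + 1)) : ¬ IsZero (A i)
  tower : IsTower A E

variable (D) in
/-- A stability condition on `D` with the support property. -/
structure StabilityCondition where
  /-- The central charge. -/
  Z : K₀ D →+ ℂ
  /-- The full additive subcategories of semistable objects of given phase. -/
  P : ℝ → ObjectProperty D
  closedUnderIso (φ : ℝ) : (P φ).IsClosedUnderIsomorphisms
  zero_mem (φ : ℝ) : P φ 0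
  biprod_mem (φ : ℝ) (A B : D) : P φ A → P φ B → P φ (A ⊞ B)
  charge (φ : ℝ) (E : D) : P φ E → ¬ IsZero E →
    ∃ m : ℝ, 0 < m ∧ Z (K₀.cls E) = m * Complex.exp (Real.pi * φ * Complex.I)
  shift (φ : ℝ) (E : D) : P (φ + 1) (E⟦(1 : ℤ)⟧) ↔ P φ E
  hom_zero (φ₁ φ₂ : ℝ) (A₁ A₂ : D) : φ₂ < φ₁ → P φ₁ A₁ → P φ₂ A₂ → ∀ f : A₁ ⟶ A₂, f = 0
  hn (E : D) : ¬ IsZero E → Nonempty (HNFiltration P E)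
  /-- The support property, for some norm `N` on `K(D) ⊗ ℝ`. -/
  support : ∃ N : Seminorm ℝ (ℝ ⊗[ℤ] K₀ D), (∀ x, N x = 0 → x = 0) ∧
    ∃ C : ℝ, 0 < C ∧ ∀ (φ : ℝ) (E : D), P φ E → ¬ IsZero E →
      C * N (1 ⊗ₜ[ℤ] K₀.cls E) < ‖Z (K₀.cls E)‖

namespace StabilityCondition

variable (σ τ : StabilityCondition D)

/-- A Harder-Narasimhan filtration of a nonzero object (it is unique up to isomorphism). -/
def hnFiltration (E : D) (hE : ¬ IsZero E) : HNFiltration σ.P E := (σ.hn E hE).some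

/-- The largest phase `φ⁺(E)` of a nonzero object. -/
def phiPlus (E : D) (hE : ¬ IsZero E) : ℝ := (σ.hnFiltration E hE).φ 0

/-- The smallest phase `φ⁻(E)` of a nonzero object. -/
def phiMinus (E : D) (hE : ¬ IsZero E) : ℝ :=
  (σ.hnFiltration E hE).φ (Fin.last (σ.hnFiltration E hE).n)

open Classical in
/-- The mass `m_{σ,t}(E) = ∑ i, |Z(A i)| * exp (φ i * t)`, and `0` for a zero object. -/
def mass (t : ℝ) (E : D) : ℝ :=
  if hE : IsZero E then 0
  else ∑ i, ‖σ.Z (K₀.cls ((σ.hnFiltration E hE).A i))‖ * Real.exp ((σ.hnFiltration E hE).φ i * t)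

/-- The sequence `(1 / n) * log m_{σ,t}(Fⁿ E)` in `[-∞, ∞]`, where `log 0 = -∞`. -/
def massSeq (F : D ⥤ D) (t : ℝ) (E : D) (n : ℕ) : EReal :=
  ENNReal.log (ENNReal.ofReal (σ.mass t (F.obj^[n] E))) / (n : EReal)

/-- The mass growth `h_{σ,t}(F)`. -/
def massGrowth (F : D ⥤ D) (t : ℝ) : EReal :=
  ⨆ E : D, limsup (σ.massSeq F t E) atTop

/-- The heart `P((0, 1])`: zero objects, and the nonzero objects with all phases in `(0, 1]`. -/
def heart : ObjectProperty D := fun E =>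
  ∀ hE : ¬ IsZero E, σ.phiPlus E hE ∈ Set.Ioc (0 : ℝ) 1 ∧ σ.phiMinus E hE ∈ Set.Ioc (0 : ℝ) 1

/-- `σ` is algebraic: in its heart (which is always an abelian category) every object has finite
length, i.e. its subobjects satisfy both chain conditions, and there are only finitely many simple
objects up to isomorphism. -/
def IsAlgebraic : Prop :=
  (∀ X : σ.heart.FullSubcategory, IsNoetherianObject X ∧ IsArtinianObject X) ∧
    ∃ s : Set σ.heart.FullSubcategory, s.Finite ∧
      ∀ X : σ.heart.FullSubcategory, Simple X → ∃ Y ∈ s, Nonempty (X ≅ Y)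

/-- The distance `d(P, Q)` between the families of semistable objects of `σ` and `τ`. -/
def slicingDist : ℝ≥0∞ :=
  ⨆ (E : D) (hE : ¬ IsZero E),
    max (ENNReal.ofReal |σ.phiMinus E hE - τ.phiMinus E hE|)
      (ENNReal.ofReal |σ.phiPlus E hE - τ.phiPlus E hE|)

/-- `‖Z - W‖_σ = sup {|Z(E) - W(E)| / |Z(E)| : E is σ-semistable}`, where `Z` and `W` are the
central charges of `σ` and `τ`. -/
def chargeDist : ℝ≥0∞ :=
  ⨆ (φ : ℝ) (E : D) (_ : σ.P φ E) (_ : ¬ IsZero E),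
    ENNReal.ofReal (‖σ.Z (K₀.cls E) - τ.Z (K₀.cls E)‖ / ‖σ.Z (K₀.cls E)‖)

/-- The basic open set `B_ε(σ)`. -/
def basicOpen (ε : ℝ) : Set (StabilityCondition D) :=
  {τ | slicingDist σ τ < ENNReal.ofReal ε ∧
    chargeDist σ τ < ENNReal.ofReal (Real.sin (Real.pi * ε))}

/-- The topology on the space of stability conditions. -/
instance : TopologicalSpace (StabilityCondition D) :=
  TopologicalSpace.generateFrom
    {U | ∃ (σ : StabilityCondition D) (ε : ℝ), 0 < ε ∧ ε < 1 / 4 ∧ U = σ.basicOpen ε}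

end StabilityCondition

end MassGrowth

end

noncomputable section

namespace MassGrowth

variable {D : Type u} [Category.{v} D] [Preadditive D] [HasZeroObject D] [HasShift D ℤ]
  [∀ n : ℤ, (shiftFunctor D n).Additive] [Pretriangulated D]

/-! Everything is compared with the complexity `δ_t(G, Fⁿ G)`; constant factors disappear after
taking `(1 / n) * log`. The limit defining the entropy exists by Fekete's lemma, since complexities
are submultiplicative (`complexity_le_mul`) and an exact functor does not increase them
(`complexity_map_le`).

For every stability condition, mass is bounded by a multiple of complexity
(`mass_le_mul_complexity`): mass is subadditive on exact triangles and `⟦n⟧` scales it by `exp (n *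
t)`. For the triangle inequality `mass_le_add`, `exp (φ * t)` is written as a positive superposition
of translated half-periods of sine. Against one half-period, a sum over Harder-Narasimhan factors
becomes a sum of imaginary parts of rotated charges of truncations, and these are subadditive by an
octahedral argument (`upper_add_le`).

The reverse bound uses the algebraic `σ₀`. Objects of its heart are iterated extensions of finitely
many simples, and a slight rotation makes the imaginary part of the charge positive on all of them.
That functional is additive while complexity is subadditive, so it controls complexity on the heart;
Harder-Narasimhan filtrations extend the bound to all objects
(`IsAlgebraic.exists_complexity_le_mass`).

Finally, masses of nearby stability conditions are comparable, because nearly aligned charges cannot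
cancel. Comparability classes are therefore clopen, and the reverse bound passes from `σ₀` to its
whole component. -/

/-- There is an exact triangle `X ⟶ Y ⟶ W ⟶ X⟦1⟧`. -/
def Tri (X Y W : D) : Prop :=
  ∃ (f : X ⟶ Y) (g : Y ⟶ W) (h : W ⟶ X⟦(1 : ℤ)⟧), Triangle.mk f g h ∈ distTriang D

/-! ### Exact triangles as a relation between objects -/

namespace Tri

variable {X Y W X' Y' W' : D}

theorem of_mem {T : Triangle D} (hT : T ∈ distTriang D) : Tri T.obj₁ T.obj₂ T.obj₃ :=
  ⟨T.mor₁, T.mor₂, T.mor₃, hT⟩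

theorem iso (h : Tri X Y W) (a : X' ≅ X) (b : Y' ≅ Y) (c : W' ≅ W) : Tri X' Y' W' := by
  obtain ⟨f, g, k, hT⟩ := h
  refine ⟨a.hom ≫ f ≫ b.inv, b.hom ≫ g ≫ c.inv, c.hom ≫ k ≫ a.inv⟦1⟧', ?_⟩
  refine isomorphic_distinguished _ hT _ (Triangle.isoMk _ _ a b c ?_ ?_ ?_)
  · change (a.hom ≫ f ≫ b.inv) ≫ b.hom = a.hom ≫ f
    simp
  · change (b.hom ≫ g ≫ c.inv) ≫ c.hom = b.hom ≫ g
    simp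
  · change (c.hom ≫ k ≫ a.inv⟦1⟧') ≫ a.hom⟦1⟧' = c.hom ≫ k
    simp [← Functor.map_comp]

theorem rotate (h : Tri X Y W) : Tri Y W (X⟦(1 : ℤ)⟧) := by
  obtain ⟨f, g, k, hT⟩ := h
  exact of_mem (rot_of_distTriang _ hT)

theorem invRotate (h : Tri X Y W) : Tri (W⟦(-1 : ℤ)⟧) X Y := by
  obtain ⟨f, g, k, hT⟩ := h
  exact of_mem (inv_rot_of_distTriang _ hT)

theorem shift (h : Tri X Y W) (n : ℤ) : Tri (X⟦n⟧) (Y⟦n⟧) (W⟦n⟧) := by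
  obtain ⟨f, g, k, hT⟩ := h
  exact of_mem (Triangle.shift_distinguished _ hT n)

theorem map {D' : Type*} [Category* D'] [Preadditive D'] [HasZeroObject D'] [HasShift D' ℤ]
    [∀ n : ℤ, (shiftFunctor D' n).Additive] [Pretriangulated D'] (F : D ⥤ D') [F.CommShift ℤ]
    [F.IsTriangulated] (h : Tri X Y W) : Tri (F.obj X) (F.obj Y) (F.obj W) := by
  obtain ⟨f, g, k, hT⟩ := h
  exact of_mem (F.map_distinguished _ hT)

theorem of_isZero_right (e : X ≅ Y) (hW : IsZero W) : Tri X Y W :=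
  iso (of_mem (contractible_distinguished X)) (Iso.refl _) e.symm (hW.iso (isZero_zero D))

theorem of_isZero_left (e : Y ≅ W) (hX : IsZero X) : Tri X Y W :=
  iso (of_mem (contractible_distinguished₁ Y)) (hX.iso (isZero_zero D)) (Iso.refl _) e.symm

theorem biprod (X Y : D) : Tri X (X ⊞ Y) Y :=
  of_mem (binaryBiproductTriangle_distinguished X Y)

theorem nonempty_iso_of_isZero_right (h : Tri X Y W) (hW : IsZero W) : Nonempty (X ≅ Y) := by
  obtain ⟨f, g, k, hT⟩ := h
  have : IsIso f := (Triangle.isZero₃_iff_isIso₁ _ hT).1 hW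
  exact ⟨asIso f⟩

theorem nonempty_iso_of_isZero_left (h : Tri X Y W) (hX : IsZero X) : Nonempty (Y ≅ W) := by
  obtain ⟨f, g, k, hT⟩ := h
  have : IsIso g := (Triangle.isZero₁_iff_isIso₂ _ hT).1 hX
  exact ⟨asIso g⟩

theorem eq_zero_of_source (h : Tri X Y W) {B : D} (hX : ∀ f : X ⟶ B, f = 0)
    (hW : ∀ f : W ⟶ B, f = 0) (f : Y ⟶ B) : f = 0 := by
  obtain ⟨a, b, c, hT⟩ := h
  obtain ⟨g, rfl⟩ : ∃ g : W ⟶ B, f = b ≫ g := Triangle.yoneda_exact₂ _ hT f (hX _)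
  rw [hW g, comp_zero]

theorem eq_zero_of_target (h : Tri X Y W) {B : D} (hX : ∀ f : B ⟶ X, f = 0)
    (hW : ∀ f : B ⟶ W, f = 0) (f : B ⟶ Y) : f = 0 := by
  obtain ⟨a, b, c, hT⟩ := h
  obtain ⟨g, rfl⟩ : ∃ g : B ⟶ X, f = g ≫ a := Triangle.coyoneda_exact₂ _ hT f (hW _)
  rw [hX g, zero_comp]

/-- The product of a pair of objects as a biproduct. -/
def piIsoBiprod (f : WalkingPair → D) : (∏ᶜ f) ≅ f .left ⊞ f .right where
  hom := biprod.lift (Pi.π f .left) (Pi.π f .right)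
  inv := Pi.lift fun | .left => biprod.fst | .right => biprod.snd
  hom_inv_id := by
    ext j
    rcases j with _ | _ <;> simp
  inv_hom_id := by ext <;> simp

/-- After one shift, a morphism killed by `f` factors through the connecting morphism `k`. This
gives uniqueness of truncations and detects monomorphisms of the heart. -/
theorem eq_zero_of_comp_eq_zero {f : X ⟶ Y} {g : Y ⟶ W} {k : W ⟶ X⟦(1 : ℤ)⟧}
    (hT : Triangle.mk f g k ∈ distTriang D) {A : D} (hA : ∀ w : A⟦(1 : ℤ)⟧ ⟶ W, w = 0)
    {u : A ⟶ X} (hu : u ≫ f = 0) : u = 0 := by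
  obtain ⟨w, hw⟩ : ∃ w : A⟦(1 : ℤ)⟧ ⟶ W, u⟦(1 : ℤ)⟧' = w ≫ k :=
    Triangle.coyoneda_exact₁ _ hT _ (by
      change u⟦(1 : ℤ)⟧' ≫ f⟦(1 : ℤ)⟧' = 0
      rw [← Functor.map_comp, hu, Functor.map_zero])
  apply (shiftFunctor D (1 : ℤ)).map_injective
  rw [hw, hA w, zero_comp, Functor.map_zero]

theorem product (h : Tri X Y W) (h' : Tri X' Y' W') : Tri (X ⊞ X') (Y ⊞ Y') (W ⊞ W') := by
  obtain ⟨f, g, k, hT⟩ := h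
  obtain ⟨f', g', k', hT'⟩ := h'
  let T : WalkingPair → Triangle D := fun j =>
    WalkingPair.casesOn j (Triangle.mk f g k) (Triangle.mk f' g' k')
  have hT : ∀ j, T j ∈ distTriang D := by rintro (_ | _) <;> assumption
  exact iso (of_mem (productTriangle_distinguished T hT)) (piIsoBiprod fun j => (T j).obj₁).symm
    (piIsoBiprod fun j => (T j).obj₂).symm (piIsoBiprod fun j => (T j).obj₃).symm

section Octahedra

variable [IsTriangulated D] {Z A : D}

/-- The octahedral axiom, for a composition `X ⟶ Y ⟶ Z`. -/
theorem comp (h : Tri X Y W) (h' : Tri Y Z A) : ∃ C, Tri X Z C ∧ Tri W C A := by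
  obtain ⟨f, g, k, hT⟩ := h
  obtain ⟨f', g', k', hT'⟩ := h'
  obtain ⟨C, p, q, hC⟩ := distinguished_cocone_triangle (f ≫ f')
  exact ⟨C, ⟨_, _, _, hC⟩, of_mem (Triangulated.someOctahedron rfl hT hT' hC).mem⟩

/-- The octahedral axiom, for a composition `Y ⟶ W ⟶ A`. -/
theorem comp' (h : Tri X Y W) (h' : Tri Z W A) : ∃ U, Tri X U Z ∧ Tri U Y A := by
  obtain ⟨f, g, k, hT⟩ := h
  obtain ⟨f', g', k', hT'⟩ := h'
  obtain ⟨C, p, q, hC⟩ := distinguished_cocone_triangle₁ (g ≫ g')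
  exact ⟨C, of_mem (Triangulated.someOctahedron' rfl hT hT' hC).mem, ⟨_, _, _, hC⟩⟩

end Octahedra

end Tri

/-! ### Classes in the Grothendieck group -/

namespace K₀

theorem cls_of_tri {X Y W : D} (h : Tri X Y W) : cls Y = cls X + cls W := by
  obtain ⟨f, g, k, hT⟩ := h
  rw [← sub_eq_zero, ← sub_sub]
  exact (QuotientAddGroup.eq_zero_iff _).2 (AddSubgroup.subset_closure ⟨_, hT, rfl⟩)

theorem cls_of_isZero {X : D} (h : IsZero X) : cls X = 0 := by
  simpa using cls_of_tri (Tri.of_isZero_right (Iso.refl X) h)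

theorem cls_of_iso {X Y : D} (e : X ≅ Y) : cls X = cls Y := by
  simpa [cls_of_isZero (isZero_zero D)] using
    (cls_of_tri (Tri.of_isZero_right e (isZero_zero D))).symm

theorem cls_shift_one (X : D) : cls (X⟦(1 : ℤ)⟧) = -cls X := by
  have := cls_of_tri (Tri.of_isZero_right (Iso.refl X) (isZero_zero D)).rotate
  rw [cls_of_isZero (isZero_zero D)] at this
  exact (neg_eq_of_add_eq_zero_right this.symm).symm

theorem norm_cls_shift (Z : K₀ D →+ ℂ) (X : D) (n : ℤ) : ‖Z (cls (X⟦n⟧))‖ = ‖Z (cls X)‖ := by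
  have h₁ (Y : D) : ‖Z (cls (Y⟦(1 : ℤ)⟧))‖ = ‖Z (cls Y)‖ := by
    rw [cls_shift_one, map_neg, norm_neg]
  induction n using Int.induction_on with
  | zero => rw [cls_of_iso ((shiftFunctorZero D ℤ).app X)]; rfl
  | succ n ih =>
    rw [cls_of_iso ((shiftFunctorAdd D (n : ℤ) 1).app X)]
    exact (h₁ _).trans ih
  | pred n ih =>
    rw [cls_of_iso ((shiftFunctorAdd' D (-(n : ℤ) - 1) 1 (-(n : ℤ)) (by ring)).app X)] at ih
    exact (h₁ _).symm.trans ih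

end K₀

/-! ### Towers -/

theorem isTower_zero_iff {A : Fin 0 → D} {E : D} : IsTower A E ↔ IsZero E := by
  constructor
  · rintro ⟨X, h₀, ⟨e⟩, -⟩
    exact h₀.of_iso e.symm
  · exact fun h => ⟨fun _ => E, h, ⟨Iso.refl _⟩, fun i => i.elim0⟩

theorem isTower_succ_iff {m : ℕ} {A : Fin (m + 1) → D} {E : D} :
    IsTower A E ↔ ∃ X, IsTower (fun i : Fin m => A i.castSucc) X ∧ Tri X E (A (Fin.last m)) := by
  constructor
  · rintro ⟨X, h₀, ⟨e⟩, h⟩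
    refine ⟨X (Fin.last m).castSucc, ⟨fun i => X i.castSucc, h₀, ⟨Iso.refl _⟩, fun i => ?_⟩, ?_⟩
    · exact h i.castSucc
    · exact Tri.iso (h (Fin.last m)) (Iso.refl _) e.symm (Iso.refl _)
  · rintro ⟨Y, ⟨X, h₀, ⟨e⟩, h⟩, hY⟩
    refine ⟨Fin.snoc (α := fun _ => D) X E, ?_, ⟨?_⟩, fun i => ?_⟩
    · rw [← Fin.castSucc_zero, Fin.snoc_castSucc]
      exact h₀
    · rw [Fin.snoc_last]
    · induction i using Fin.lastCases with
      | last =>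
        rw [Fin.succ_last, Fin.snoc_last, Fin.snoc_castSucc]
        exact hY.iso e (Iso.refl _) (Iso.refl _)
      | cast i =>
        rw [Fin.succ_castSucc, Fin.snoc_castSucc, Fin.snoc_castSucc]
        exact h i

theorem K₀.cls_of_isTower {m : ℕ} {A : Fin m → D} {E : D} (h : IsTower A E) :
    K₀.cls E = ∑ i, K₀.cls (A i) := by
  induction m generalizing E with
  | zero => simp [K₀.cls_of_isZero (isTower_zero_iff.1 h)]
  | succ m ih =>
    obtain ⟨X, hX, hE⟩ := isTower_succ_iff.1 h
    rw [K₀.cls_of_tri hE, Fin.sum_univ_castSucc, ih hX]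

theorem IsTower.shift {m : ℕ} {A : Fin m → D} {E : D} (h : IsTower A E) (n : ℤ) :
    IsTower (fun i => (A i)⟦n⟧) (E⟦n⟧) := by
  induction m generalizing E with
  | zero => exact isTower_zero_iff.2 ((shiftFunctor D n).map_isZero (isTower_zero_iff.1 h))
  | succ m ih =>
    obtain ⟨X, hX, hE⟩ := isTower_succ_iff.1 h
    exact isTower_succ_iff.2 ⟨_, ih hX, hE.shift n⟩

/-! ### Extension closures -/

/-- The closure of a property of objects under zero objects and extensions. -/
inductive ExtClosure (S : ObjectProperty D) : ObjectProperty D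
  | zero {X : D} : IsZero X → ExtClosure S X
  | of {X : D} : S X → ExtClosure S X
  | ext {X Y W : D} : Tri X Y W → ExtClosure S X → ExtClosure S W → ExtClosure S Y

namespace ExtClosure

variable {S : ObjectProperty D}

theorem iso {X Y : D} (h : ExtClosure S X) (e : X ≅ Y) : ExtClosure S Y :=
  ext (Tri.of_isZero_right e (isZero_zero D)) h (zero (isZero_zero D))

theorem mono {S' : ObjectProperty D} (hS : ∀ X, S X → S' X) {X : D} (h : ExtClosure S X) :
    ExtClosure S' X := by
  induction h with
  | zero h => exact zero h
  | of h => exact of (hS _ h)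
  | ext h _ _ h₁ h₂ => exact ext h h₁ h₂

theorem shift {S' : ObjectProperty D} (n : ℤ) (hS : ∀ X, S X → S' (X⟦n⟧)) {X : D}
    (h : ExtClosure S X) : ExtClosure S' (X⟦n⟧) := by
  induction h with
  | zero h => exact zero ((shiftFunctor D n).map_isZero h)
  | of h => exact of (hS _ h)
  | ext h _ _ h₁ h₂ => exact ext (h.shift n) h₁ h₂

theorem of_isTower {m : ℕ} {A : Fin m → D} {E : D} (h : IsTower A E) (hA : ∀ i, S (A i)) :
    ExtClosure S E := by
  induction m generalizing E with
  | zero => exact zero (isTower_zero_iff.1 h)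
  | succ m ih =>
    obtain ⟨X, hX, hE⟩ := isTower_succ_iff.1 h
    exact ext hE (ih hX fun i => hA _) (of (hA _))

theorem hom_eq_zero {S' : ObjectProperty D} (hS : ∀ X Y, S X → S' Y → ∀ f : X ⟶ Y, f = 0)
    {X Y : D} (hX : ExtClosure S X) (hY : ExtClosure S' Y) (f : X ⟶ Y) : f = 0 := by
  induction hX with
  | zero h => exact h.eq_of_src _ _
  | ext h _ _ h₁ h₂ => exact h.eq_zero_of_source h₁ h₂ f
  | of hX =>
    induction hY with
    | zero h => exact h.eq_of_tgt _ _
    | of hY => exact hS _ _ hX hY f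
    | ext h _ _ h₁ h₂ => exact h.eq_zero_of_target h₁ h₂ f

end ExtClosure

namespace StabilityCondition

variable (σ : StabilityCondition D)

/-! ### The t-structures of a stability condition -/

/-- The objects built from semistable objects of phase `> θ`. -/
def gt (θ : ℝ) : ObjectProperty D := ExtClosure fun E => ∃ φ, θ < φ ∧ σ.P φ E

/-- The objects built from semistable objects of phase `≤ θ`. -/
def le (θ : ℝ) : ObjectProperty D := ExtClosure fun E => ∃ φ, φ ≤ θ ∧ σ.P φ E

variable {σ}

theorem P_iso {φ : ℝ} {X Y : D} (h : σ.P φ X) (e : X ≅ Y) : σ.P φ Y :=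
  (σ.closedUnderIso φ).of_iso e h

theorem P_shift {φ : ℝ} {X : D} (h : σ.P φ X) (n : ℤ) : σ.P (φ + n) (X⟦n⟧) := by
  induction n using Int.induction_on with
  | zero =>
    rw [Int.cast_zero, add_zero]
    exact P_iso h ((shiftFunctorZero D ℤ).app X).symm
  | succ n ih =>
    have := P_iso ((σ.shift _ _).2 ih) ((shiftFunctorAdd D (n : ℤ) 1).app X).symm
    convert this using 1
    push_cast
    ring
  | pred n ih =>
    rw [← σ.shift]
    rw [show φ + ((-(n : ℤ) - 1 : ℤ) : ℝ) + 1 = φ + ((-(n : ℤ) : ℤ) : ℝ) by push_cast; ring]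
    exact P_iso ih ((shiftFunctorAdd' D (-(n : ℤ) - 1) 1 (-(n : ℤ)) (by ring)).app X)

theorem gt_mono {θ θ' : ℝ} (h : θ' ≤ θ) {X : D} (hX : σ.gt θ X) : σ.gt θ' X :=
  ExtClosure.mono (fun _ ⟨φ, h₁, h₂⟩ => ⟨φ, h.trans_lt h₁, h₂⟩) hX

theorem le_mono {θ θ' : ℝ} (h : θ ≤ θ') {X : D} (hX : σ.le θ X) : σ.le θ' X :=
  ExtClosure.mono (fun _ ⟨φ, h₁, h₂⟩ => ⟨φ, h₁.trans h, h₂⟩) hX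

theorem gt_of_P {φ θ : ℝ} (h : θ < φ) {X : D} (hX : σ.P φ X) : σ.gt θ X := .of ⟨φ, h, hX⟩

theorem le_of_P {φ θ : ℝ} (h : φ ≤ θ) {X : D} (hX : σ.P φ X) : σ.le θ X := .of ⟨φ, h, hX⟩

theorem gt_shift {θ : ℝ} {X : D} (h : σ.gt θ X) (n : ℤ) : σ.gt (θ + n) (X⟦n⟧) :=
  ExtClosure.shift n (fun _ ⟨φ, h₁, h₂⟩ => ⟨φ + n, by linarith, P_shift h₂ n⟩) h

theorem le_shift {θ : ℝ} {X : D} (h : σ.le θ X) (n : ℤ) : σ.le (θ + n) (X⟦n⟧) :=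
  ExtClosure.shift n (fun _ ⟨φ, h₁, h₂⟩ => ⟨φ + n, by linarith, P_shift h₂ n⟩) h

theorem gt_shift_one {θ : ℝ} {X : D} (h : σ.gt θ X) : σ.gt (θ + 1) (X⟦(1 : ℤ)⟧) := by
  simpa using gt_shift h 1

theorem le_shift_one {θ : ℝ} {X : D} (h : σ.le θ X) : σ.le (θ + 1) (X⟦(1 : ℤ)⟧) := by
  simpa using le_shift h 1

theorem hom_gt_le {θ : ℝ} {X Y : D} (hX : σ.gt θ X) (hY : σ.le θ Y) (f : X ⟶ Y) : f = 0 :=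
  ExtClosure.hom_eq_zero
    (fun _ _ ⟨φ, h₁, h₂⟩ ⟨ψ, h₃, h₄⟩ => σ.hom_zero φ ψ _ _ (h₃.trans_lt h₁) h₂ h₄) hX hY f

theorem isZero_of_gt_le {θ : ℝ} {X : D} (hX : σ.gt θ X) (hX' : σ.le θ X) : IsZero X := by
  rw [IsZero.iff_id_eq_zero]
  exact hom_gt_le hX hX' _

/-- `W` is an extension of `X⟦1⟧` by `Y`, so it has phases both `> θ` and `≤ θ`. -/
theorem isZero_right_of_gt {θ : ℝ} {X Y W : D} (h : Tri X Y W) (hX : σ.gt θ X) (hY : σ.gt θ Y)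
    (hW : σ.le θ W) : IsZero W :=
  isZero_of_gt_le (.ext h.rotate hY (gt_mono (by linarith) (gt_shift_one hX))) hW

theorem isZero_left_of_le {θ : ℝ} {X Y W : D} (h : Tri X Y W) (hX : σ.gt θ X) (hY : σ.le θ Y)
    (hW : σ.le θ W) : IsZero X :=
  isZero_of_gt_le hX (.ext h.invRotate (le_mono (by norm_num) (le_shift hW (-1))) hY)

section Truncation

variable [IsTriangulated D]

/-- Phases decrease along the tower, so the part of phase `> θ` is an initial segment; octahedra
collect the remaining factors. The last two clauses serve to compute `upper` and to bound the phases
of an arbitrary filtration. -/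
theorem exists_truncation_of_isTower {m : ℕ} {φ : Fin m → ℝ} {A : Fin m → D} {E : D}
    (hφ : StrictAnti φ) (hA : ∀ i, σ.P (φ i) (A i)) (hA' : ∀ i, ¬ IsZero (A i))
    (h : IsTower A E) (θ : ℝ) :
    ∃ E' E'', Tri E' E E'' ∧ σ.gt θ E' ∧ σ.le θ E'' ∧
      K₀.cls E' = ∑ i, (if θ < φ i then K₀.cls (A i) else 0) ∧ (IsZero E' → ∀ i, φ i ≤ θ) := by
  induction m generalizing E with
  | zero =>
    have hE := isTower_zero_iff.1 h
    exact ⟨E, E, Tri.of_isZero_right (Iso.refl _) hE, .zero hE, .zero hE,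
      by simp [K₀.cls_of_isZero hE], fun _ i => i.elim0⟩
  | succ m ih =>
    obtain ⟨X, hX, hE⟩ := isTower_succ_iff.1 h
    have hφ' : StrictAnti fun i : Fin m => φ i.castSucc :=
      fun i j hij => hφ (Fin.castSucc_lt_castSucc_iff.2 hij)
    by_cases hlast : θ < φ (Fin.last m)
    · have hgt : ∀ i, θ < φ i := fun i => hlast.trans_le (hφ.antitone (Fin.le_last i))
      refine ⟨E, 0, Tri.of_isZero_right (Iso.refl _) (isZero_zero D),
        ExtClosure.of_isTower h fun i => ⟨_, hgt i, hA i⟩, .zero (isZero_zero D), ?_, ?_⟩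
      · simp [hgt, K₀.cls_of_isTower h]
      · intro h0
        have hX' : σ.gt (φ (Fin.last m)) X := ExtClosure.of_isTower hX
          fun i => ⟨_, hφ (Fin.castSucc_lt_last i), hA _⟩
        exact absurd (isZero_right_of_gt hE hX' (.zero h0) (le_of_P le_rfl (hA _))) (hA' _)
    · obtain ⟨E', X'', h₁, h₂, h₃, h₄, h₅⟩ := ih hφ' (fun i => hA _) (fun i => hA' _) hX
      obtain ⟨E'', h₆, h₇⟩ := h₁.comp hE
      refine ⟨E', E'', h₆, h₂, .ext h₇ h₃ (le_of_P (not_lt.1 hlast) (hA _)), ?_, fun h0 i => ?_⟩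
      · rw [h₄, Fin.sum_univ_castSucc, if_neg hlast, add_zero]
      · induction i using Fin.lastCases with
        | last => exact not_lt.1 hlast
        | cast i => exact h₅ h0 i

theorem exists_truncation_of_hn {E : D} (H : HNFiltration σ.P E) (θ : ℝ) :
    ∃ E' E'', Tri E' E E'' ∧ σ.gt θ E' ∧ σ.le θ E'' ∧
      K₀.cls E' = ∑ i, (if θ < H.φ i then K₀.cls (H.A i) else 0) ∧
        (IsZero E' → ∀ i, H.φ i ≤ θ) :=
  exists_truncation_of_isTower H.φ_strictAnti H.mem H.not_isZero H.tower θ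

variable (σ) in
theorem exists_truncation (E : D) (θ : ℝ) : ∃ E' E'', Tri E' E E'' ∧ σ.gt θ E' ∧ σ.le θ E'' := by
  by_cases hE : IsZero E
  · exact ⟨E, E, Tri.of_isZero_right (Iso.refl _) hE, .zero hE, .zero hE⟩
  · obtain ⟨E', E'', h₁, h₂, h₃, -⟩ := exists_truncation_of_hn (σ.hnFiltration E hE) θ
    exact ⟨E', E'', h₁, h₂, h₃⟩

end Truncation

theorem nonempty_iso_of_truncation {E X X' Y Y' : D} {θ : ℝ} (h : Tri X E X') (h' : Tri Y E Y')
    (hX : σ.gt θ X) (hX' : σ.le θ X') (hY : σ.gt θ Y) (hY' : σ.le θ Y') : Nonempty (X ≅ Y) := by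
  obtain ⟨f, g, k, hT⟩ := h
  obtain ⟨f', g', k', hT'⟩ := h'
  obtain ⟨a, ha⟩ : ∃ a : X ⟶ Y, f = a ≫ f' :=
    Triangle.coyoneda_exact₂ _ hT' f (hom_gt_le hX hY' _)
  obtain ⟨b, hb⟩ : ∃ b : Y ⟶ X, f' = b ≫ f :=
    Triangle.coyoneda_exact₂ _ hT f' (hom_gt_le hY hX' _)
  refine ⟨⟨a, b, ?_, ?_⟩⟩
  · rw [← sub_eq_zero]
    refine Tri.eq_zero_of_comp_eq_zero hT
      (hom_gt_le (gt_mono (by linarith) (gt_shift_one hX)) hX') ?_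
    rw [Preadditive.sub_comp, Category.assoc, ← hb, ← ha, Category.id_comp, sub_self]
  · rw [← sub_eq_zero]
    refine Tri.eq_zero_of_comp_eq_zero hT'
      (hom_gt_le (gt_mono (by linarith) (gt_shift_one hY)) hY') ?_
    rw [Preadditive.sub_comp, Category.assoc, ← ha, ← hb, Category.id_comp, sub_self]

/-! ### Phases -/

section Phases

variable {E : D} (H : HNFiltration σ.P E) {θ : ℝ}

theorem phi_le (i : Fin (H.n + 1)) : H.φ i ≤ H.φ 0 := H.φ_strictAnti.antitone (Fin.zero_le i)

theorem le_phi (i : Fin (H.n + 1)) : H.φ (Fin.last H.n) ≤ H.φ i :=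
  H.φ_strictAnti.antitone (Fin.le_last i)

theorem gt_of_hn (h : θ < H.φ (Fin.last H.n)) : σ.gt θ E :=
  ExtClosure.of_isTower H.tower fun i => ⟨_, h.trans_le (le_phi H i), H.mem i⟩

theorem le_of_hn (h : H.φ 0 ≤ θ) : σ.le θ E :=
  ExtClosure.of_isTower H.tower fun i => ⟨_, (phi_le H i).trans h, H.mem i⟩

/-- Otherwise the last factor would be built from objects of phase larger than its own, hence zero.
As `H` is arbitrary, the extreme phases do not depend on the chosen filtration. -/
theorem lt_phi_of_gt (h : σ.gt θ E) (i : Fin (H.n + 1)) : θ < H.φ i := by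
  refine lt_of_lt_of_le ?_ (le_phi H i)
  by_contra! hlast
  obtain ⟨X, hX, hE⟩ := isTower_succ_iff.1 H.tower
  have hX' : σ.gt (H.φ (Fin.last H.n)) X := ExtClosure.of_isTower hX
    fun i => ⟨_, H.φ_strictAnti (Fin.castSucc_lt_last i), H.mem _⟩
  exact H.not_isZero _ (isZero_right_of_gt hE hX' (gt_mono hlast h) (le_of_P le_rfl (H.mem _)))

variable [IsTriangulated D]

theorem phi_le_of_le (h : σ.le θ E) (i : Fin (H.n + 1)) : H.φ i ≤ θ := by
  obtain ⟨E', E'', h₁, h₂, h₃, -, h₄⟩ := exists_truncation_of_hn H θ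
  exact h₄ (isZero_left_of_le h₁ h₂ h h₃) i

theorem phi_eq_of_P {φ : ℝ} (h : σ.P φ E) (i : Fin (H.n + 1)) : H.φ i = φ :=
  le_antisymm (phi_le_of_le H (le_of_P le_rfl h) i)
    (le_of_forall_lt fun _ hθ => lt_phi_of_gt H (gt_of_P hθ h) i)

theorem heart_iff {E : D} : σ.heart E ↔ σ.gt 0 E ∧ σ.le 1 E := by
  constructor
  · intro h
    by_cases hE : IsZero E
    · exact ⟨.zero hE, .zero hE⟩
    · exact ⟨gt_of_hn (σ.hnFiltration E hE) (h hE).2.1, le_of_hn (σ.hnFiltration E hE) (h hE).1.2⟩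
  · rintro ⟨h₁, h₂⟩ hE
    exact ⟨⟨lt_phi_of_gt _ h₁ _, phi_le_of_le _ h₂ _⟩, ⟨lt_phi_of_gt _ h₁ _, phi_le_of_le _ h₂ _⟩⟩

end Phases

end StabilityCondition

/-! ### The triangle inequality for masses -/

/-- One arch of the function `sin (π x)`, supported on the unit interval. -/
def arch (x : ℝ) : ℝ := Real.sin (Real.pi * max 0 (min x 1))

theorem arch_nonneg (x : ℝ) : 0 ≤ arch x := by
  refine Real.sin_nonneg_of_nonneg_of_le_pi (by positivity) ?_
  have : max 0 (min x 1) ≤ 1 := max_le zero_le_one (min_le_right _ _)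
  nlinarith [Real.pi_pos]

theorem continuous_arch : Continuous arch := by
  unfold arch
  fun_prop

theorem arch_of_nonpos {x : ℝ} (h : x ≤ 0) : arch x = 0 := by
  rw [arch, max_eq_left ((min_le_left _ _).trans h), mul_zero, Real.sin_zero]

theorem arch_of_one_le {x : ℝ} (h : 1 ≤ x) : arch x = 0 := by
  rw [arch, min_eq_right h, max_eq_right zero_le_one, mul_one, Real.sin_pi]

theorem arch_of_mem {x : ℝ} (h₀ : 0 ≤ x) (h₁ : x ≤ 1) : arch x = Real.sin (Real.pi * x) := by
  rw [arch, min_eq_left h₁, max_eq_right h₀]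

theorem hasCompactSupport_arch : HasCompactSupport arch := by
  refine HasCompactSupport.intro (isCompact_Icc (a := (0 : ℝ)) (b := 1)) fun x hx => ?_
  rw [Set.mem_Icc, not_and_or, not_le, not_le] at hx
  rcases hx with hx | hx
  · exact arch_of_nonpos hx.le
  · exact arch_of_one_le hx.le

/-- The factor relating `exp (t φ)` to its decomposition into arches. -/
def archFactor (t : ℝ) : ℝ := ∫ x, Real.exp (-(t * x)) * arch x

theorem archFactor_pos (t : ℝ) : 0 < archFactor t := by
  refine Continuous.integral_pos_of_hasCompactSupport_nonneg_nonzero (x := 1 / 2) ?_ ?_ ?_ ?_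
  · exact (by fun_prop : Continuous fun x : ℝ => Real.exp (-(t * x))).mul continuous_arch
  · exact hasCompactSupport_arch.mul_left
  · exact fun x => mul_nonneg (Real.exp_pos _).le (arch_nonneg x)
  · rw [arch_of_mem (by norm_num) (by norm_num), mul_one_div Real.pi, Real.sin_pi_div_two, mul_one]
    exact (Real.exp_pos _).ne'

theorem integrable_exp_mul_arch (t φ : ℝ) :
    MeasureTheory.Integrable fun θ => Real.exp (t * θ) * arch (φ - θ) := by
  refine Continuous.integrable_of_hasCompactSupport ?_ ?_
  · exact (by fun_prop : Continuous fun x : ℝ => Real.exp (t * x)).mul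
      (continuous_arch.comp (by fun_prop))
  · exact (hasCompactSupport_arch.comp_homeomorph (Homeomorph.subLeft φ)).mul_left

/-- Substitute `θ = φ - x`; the remaining factor is independent of `φ`. -/
theorem integral_exp_mul_arch (t φ : ℝ) :
    ∫ θ, Real.exp (t * θ) * arch (φ - θ) = Real.exp (φ * t) * archFactor t := by
  have := MeasureTheory.integral_sub_left_eq_self
    (fun x => Real.exp (t * (φ - x)) * arch x) MeasureTheory.volume φ
  simp only [sub_sub_cancel] at this
  rw [this, archFactor, ← MeasureTheory.integral_const_mul]
  refine MeasureTheory.integral_congr_ae (.of_forall fun x => ?_)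
  change Real.exp (t * (φ - x)) * arch x = Real.exp (φ * t) * (Real.exp (-(t * x)) * arch x)
  rw [← mul_assoc, ← Real.exp_add]
  ring_nf

/-- The imaginary part after rotation by `-π θ`. -/
def rotIm (θ : ℝ) : ℂ →+ ℝ :=
  Complex.imAddGroupHom.comp (AddMonoidHom.mulLeft (Complex.exp (-(Real.pi * θ * Complex.I))))

theorem rotIm_mul_exp (θ φ m : ℝ) :
    rotIm θ (m * Complex.exp (Real.pi * φ * Complex.I)) = m * Real.sin (Real.pi * (φ - θ)) := by
  have h : Complex.exp (-(Real.pi * θ * Complex.I)) * (m * Complex.exp (Real.pi * φ * Complex.I))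
      = m * Complex.exp ((Real.pi * (φ - θ) : ℝ) * Complex.I) := by
    rw [mul_left_comm, ← Complex.exp_add]
    congr 2
    push_cast
    ring
  change (Complex.exp (-(Real.pi * θ * Complex.I)) *
    (m * Complex.exp (Real.pi * φ * Complex.I))).im = _
  rw [h, Complex.im_ofReal_mul, Complex.exp_ofReal_mul_I_im]

namespace StabilityCondition

variable {σ : StabilityCondition D}

theorem charge_eq {φ : ℝ} {E : D} (h : σ.P φ E) (hE : ¬ IsZero E) :
    σ.Z (K₀.cls E) = ‖σ.Z (K₀.cls E)‖ * Complex.exp (Real.pi * φ * Complex.I) := by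
  obtain ⟨m, hm, h⟩ := σ.charge φ E h hE
  rw [h, norm_mul, Complex.norm_real, Real.norm_of_nonneg hm.le]
  rw [← Complex.ofReal_mul, Complex.norm_exp_ofReal_mul_I, mul_one]

theorem norm_charge_pos {φ : ℝ} {E : D} (h : σ.P φ E) (hE : ¬ IsZero E) :
    0 < ‖σ.Z (K₀.cls E)‖ := by
  obtain ⟨m, hm, h⟩ := σ.charge φ E h hE
  rw [h]
  exact norm_pos_iff.2 (mul_ne_zero (by exact_mod_cast hm.ne') (Complex.exp_ne_zero _))

theorem rotIm_charge (θ : ℝ) {φ : ℝ} {E : D} (h : σ.P φ E) (hE : ¬ IsZero E) :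
    rotIm θ (σ.Z (K₀.cls E)) = ‖σ.Z (K₀.cls E)‖ * Real.sin (Real.pi * (φ - θ)) := by
  conv_lhs => rw [charge_eq h hE]
  exact rotIm_mul_exp _ _ _

variable [IsTriangulated D]

theorem rotIm_nonneg {θ : ℝ} {K : D} (h₁ : σ.gt θ K) (h₂ : σ.le (θ + 1) K) :
    0 ≤ rotIm θ (σ.Z (K₀.cls K)) := by
  by_cases hK : IsZero K
  · simp [K₀.cls_of_isZero hK]
  · have H := σ.hnFiltration K hK
    rw [K₀.cls_of_isTower H.tower, map_sum, map_sum]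
    refine Finset.sum_nonneg fun i _ => ?_
    rw [rotIm_charge θ (H.mem i) (H.not_isZero i)]
    have h₁ := lt_phi_of_gt H h₁ i
    have h₂ := phi_le_of_le H h₂ i
    refine mul_nonneg (norm_nonneg _) (Real.sin_nonneg_of_nonneg_of_le_pi ?_ ?_)
    · exact mul_nonneg Real.pi_pos.le (by linarith)
    · nlinarith [Real.pi_pos]

variable (σ) in
/-- The rotated imaginary part of the central charge of the part of phase `> θ`. -/
def upper (θ : ℝ) (E : D) : ℝ := rotIm θ (σ.Z (K₀.cls (σ.exists_truncation E θ).choose))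

theorem upper_eq {θ : ℝ} {E E' E'' : D} (h : Tri E' E E'') (h' : σ.gt θ E') (h'' : σ.le θ E'') :
    σ.upper θ E = rotIm θ (σ.Z (K₀.cls E')) := by
  obtain ⟨F, h₁, h₂, h₃⟩ := (σ.exists_truncation E θ).choose_spec
  rw [upper, K₀.cls_of_iso (nonempty_iso_of_truncation h₁ h h₂ h₃ h' h'').some]

theorem upper_add_le {θ : ℝ} {X Y W : D} (h : Tri X Y W) :
    σ.upper θ Y ≤ σ.upper θ X + σ.upper θ W := by
  obtain ⟨X', X'', hX, hX', hX''⟩ := σ.exists_truncation X θ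
  obtain ⟨W', W'', hW, hW', hW''⟩ := σ.exists_truncation W θ
  -- `U` is the preimage of `W'` in `Y`, and `V`, the quotient of `U` by `X'`, is an extension of
  -- `W'` by `X''`.
  obtain ⟨U, hU, hUY⟩ := h.comp' hW
  obtain ⟨V, hV, hXV⟩ := hX.comp hU
  obtain ⟨V', V'', hV₀, hV', hV''⟩ := σ.exists_truncation V θ
  -- `U'`, the extension of `V'` by `X'`, turns out to be the part of `Y` of phase `> θ`.
  obtain ⟨U', hU', hU₁⟩ := hV.comp' hV₀
  obtain ⟨C, hC, hVC⟩ := hU₁.comp hUY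
  -- `K`, the cone of `V' ⟶ W'`, is the defect: `[U'] = [X'] + [W'] - [K]`, and `K` has phases in
  -- `(θ, θ + 1]`, where the rotated imaginary part is nonnegative.
  obtain ⟨K, hK, hK'⟩ := hV₀.comp hXV.rotate
  have hY := upper_eq hC (.ext hU' hX' hV') (.ext hVC hV'' hW'')
  rw [hY, upper_eq hX hX' hX'', upper_eq hW hW' hW'', K₀.cls_of_tri hU', K₀.cls_of_tri hK]
  have := rotIm_nonneg (σ := σ) (θ := θ) (K := K)
    (.ext hK.rotate hW' (gt_mono (by linarith) (gt_shift_one hV')))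
    (.ext hK' (le_mono (by linarith) hV'') (le_shift_one hX''))
  simp only [map_add]
  linarith

theorem upper_biprod (θ : ℝ) (X Y : D) : σ.upper θ (X ⊞ Y) = σ.upper θ X + σ.upper θ Y := by
  obtain ⟨X', X'', hX, hX', hX''⟩ := σ.exists_truncation X θ
  obtain ⟨Y', Y'', hY, hY', hY''⟩ := σ.exists_truncation Y θ
  rw [upper_eq hX hX' hX'', upper_eq hY hY' hY'',
    upper_eq (hX.product hY) (.ext (Tri.biprod _ _) hX' hY') (.ext (Tri.biprod _ _) hX'' hY''),
    K₀.cls_of_tri (Tri.biprod _ _), map_add, map_add]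

theorem upper_of_isZero (θ : ℝ) {X : D} (h : IsZero X) : σ.upper θ X = 0 := by
  rw [upper_eq (Tri.of_isZero_right (Iso.refl X) h) (.zero h) (.zero h), K₀.cls_of_isZero h,
    map_zero, map_zero]

/-- The sines at `θ` and `θ + 1` are opposite, so factors of phase `> θ + 1` cancel and a single
arch survives. -/
theorem upper_add_upper {θ : ℝ} {E : D} (H : HNFiltration σ.P E) :
    σ.upper θ E + σ.upper (θ + 1) E = ∑ i, ‖σ.Z (K₀.cls (H.A i))‖ * arch (H.φ i - θ) := by
  have key (θ : ℝ) : σ.upper θ E = ∑ i, if θ < H.φ i then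
      ‖σ.Z (K₀.cls (H.A i))‖ * Real.sin (Real.pi * (H.φ i - θ)) else 0 := by
    obtain ⟨E', E'', h, h', h'', hc, -⟩ := exists_truncation_of_hn H θ
    rw [upper_eq h h' h'', hc, map_sum, map_sum]
    refine Finset.sum_congr rfl fun i _ => ?_
    split_ifs
    · exact rotIm_charge θ (H.mem i) (H.not_isZero i)
    · simp
  rw [key, key, ← Finset.sum_add_distrib]
  refine Finset.sum_congr rfl fun i _ => ?_
  have hsin : Real.sin (Real.pi * (H.φ i - (θ + 1))) = -Real.sin (Real.pi * (H.φ i - θ)) := by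
    rw [← Real.sin_sub_pi]
    ring_nf
  rw [hsin]
  split_ifs with h₁ h₂ h₂
  · rw [arch_of_one_le (by linarith)]
    ring
  · rw [arch_of_mem (by linarith) (by linarith), add_zero]
  · linarith
  · rw [arch_of_nonpos (by linarith)]
    ring

omit [IsTriangulated D] in
theorem mass_of_isZero (t : ℝ) {E : D} (h : IsZero E) : σ.mass t E = 0 := dif_pos h

theorem mass_mul_archFactor (t : ℝ) (E : D) :
    MeasureTheory.Integrable (fun θ => Real.exp (t * θ) * (σ.upper θ E + σ.upper (θ + 1) E)) ∧
      ∫ θ, Real.exp (t * θ) * (σ.upper θ E + σ.upper (θ + 1) E) = σ.mass t E * archFactor t := by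
  by_cases hE : IsZero E
  · simp [upper_of_isZero _ hE, mass_of_isZero t hE]
  · set H := σ.hnFiltration E hE with hH
    have hfun : (fun θ => Real.exp (t * θ) * (σ.upper θ E + σ.upper (θ + 1) E)) = fun θ =>
        ∑ i, ‖σ.Z (K₀.cls (H.A i))‖ * (Real.exp (t * θ) * arch (H.φ i - θ)) := by
      funext θ
      rw [upper_add_upper H, Finset.mul_sum]
      exact Finset.sum_congr rfl fun i _ => mul_left_comm _ _ _
    have hint (i) : MeasureTheory.Integrable fun θ =>
        ‖σ.Z (K₀.cls (H.A i))‖ * (Real.exp (t * θ) * arch (H.φ i - θ)) :=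
      (integrable_exp_mul_arch t _).const_mul _
    rw [hfun]
    refine ⟨MeasureTheory.integrable_finsetSum _ fun i _ => hint i, ?_⟩
    rw [MeasureTheory.integral_finsetSum _ fun i _ => hint i, mass, dif_neg hE, ← hH,
      Finset.sum_mul]
    refine Finset.sum_congr rfl fun i _ => ?_
    rw [MeasureTheory.integral_const_mul, integral_exp_mul_arch, mul_assoc]

/-- The mass does not depend on the choice of a Harder-Narasimhan filtration. -/
theorem mass_eq (t : ℝ) {E : D} (H : HNFiltration σ.P E) :
    σ.mass t E = ∑ i, ‖σ.Z (K₀.cls (H.A i))‖ * Real.exp (H.φ i * t) := by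
  -- `upper` depends on `E` alone, so the integral formula gives the same value for every
  -- filtration.
  refine mul_right_cancel₀ (archFactor_pos t).ne' ?_
  rw [← (mass_mul_archFactor t E).2, Finset.sum_mul]
  simp only [upper_add_upper H, Finset.mul_sum, mul_left_comm (Real.exp _)]
  rw [MeasureTheory.integral_finsetSum _ fun i _ => (integrable_exp_mul_arch t _).const_mul _]
  refine Finset.sum_congr rfl fun i _ => ?_
  rw [MeasureTheory.integral_const_mul, integral_exp_mul_arch, mul_assoc]

omit [IsTriangulated D] in
theorem mass_nonneg (t : ℝ) (E : D) : 0 ≤ σ.mass t E := by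
  rw [mass]
  split_ifs
  · rfl
  · exact Finset.sum_nonneg fun i _ => by positivity

/-- The triangle inequality for masses. -/
theorem mass_le_add (t : ℝ) {X Y W : D} (h : Tri X Y W) :
    σ.mass t Y ≤ σ.mass t X + σ.mass t W := by
  refine le_of_mul_le_mul_right ?_ (archFactor_pos t)
  have hX := mass_mul_archFactor (σ := σ) t X
  have hY := mass_mul_archFactor (σ := σ) t Y
  have hW := mass_mul_archFactor (σ := σ) t W
  rw [add_mul, ← hX.2, ← hY.2, ← hW.2, ← MeasureTheory.integral_add hX.1 hW.1]
  refine MeasureTheory.integral_mono hY.1 (hX.1.add hW.1) fun θ => ?_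
  have h₁ := upper_add_le (σ := σ) (θ := θ) h
  have h₂ := upper_add_le (σ := σ) (θ := θ + 1) h
  change Real.exp (t * θ) * _ ≤ Real.exp (t * θ) * _ + Real.exp (t * θ) * _
  rw [← mul_add]
  exact mul_le_mul_of_nonneg_left (by linarith) (Real.exp_pos _).le

/-- Truncations commute with direct sums. The equality allows the complement `E'` in the definition
of complexity to be discarded. -/
theorem mass_biprod (t : ℝ) (X Y : D) : σ.mass t (X ⊞ Y) = σ.mass t X + σ.mass t Y := by
  refine mul_right_cancel₀ (archFactor_pos t).ne' ?_
  have hX := mass_mul_archFactor (σ := σ) t X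
  have hY := mass_mul_archFactor (σ := σ) t Y
  rw [add_mul, ← hX.2, ← hY.2, ← (mass_mul_archFactor t _).2,
    ← MeasureTheory.integral_add hX.1 hY.1]
  simp only [upper_biprod]
  congr 1
  ext θ
  ring

theorem mass_le_of_isTower (t : ℝ) {m : ℕ} {A : Fin m → D} {E : D} (h : IsTower A E) :
    σ.mass t E ≤ ∑ i, σ.mass t (A i) := by
  induction m generalizing E with
  | zero => simp [mass_of_isZero t (isTower_zero_iff.1 h)]
  | succ m ih =>
    obtain ⟨X, hX, hE⟩ := isTower_succ_iff.1 h
    rw [Fin.sum_univ_castSucc]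
    exact (mass_le_add t hE).trans (add_le_add (ih hX) le_rfl)

/-- The Harder-Narasimhan filtration of a semistable object. -/
def hnOfMem {φ : ℝ} {E : D} (h : σ.P φ E) (hE : ¬ IsZero E) : HNFiltration σ.P E where
  n := 0
  φ _ := φ
  A _ := E
  φ_strictAnti i j h := absurd h (by omega)
  mem _ := h
  not_isZero _ := hE
  tower := isTower_succ_iff.2 ⟨0, isTower_zero_iff.2 (isZero_zero D),
    Tri.of_isZero_left (Iso.refl E) (isZero_zero D)⟩

/-- The shift of a Harder-Narasimhan filtration. -/
def hnShift {E : D} (H : HNFiltration σ.P E) (n : ℤ) : HNFiltration σ.P (E⟦n⟧) where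
  n := H.n
  φ i := H.φ i + n
  A i := (H.A i)⟦n⟧
  φ_strictAnti := H.φ_strictAnti.add_const _
  mem i := P_shift (H.mem i) n
  not_isZero i h := H.not_isZero i (IsZero.of_full_of_faithful_of_isZero (shiftFunctor D n) _ h)
  tower := H.tower.shift n

theorem mass_of_P (t : ℝ) {φ : ℝ} {E : D} (h : σ.P φ E) (hE : ¬ IsZero E) :
    σ.mass t E = ‖σ.Z (K₀.cls E)‖ * Real.exp (φ * t) :=
  (mass_eq t (hnOfMem h hE)).trans (Fin.sum_univ_one _)

theorem mass_shift (t : ℝ) (n : ℤ) (E : D) :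
    σ.mass t (E⟦n⟧) = Real.exp (n * t) * σ.mass t E := by
  by_cases hE : IsZero E
  · rw [mass_of_isZero t hE, mass_of_isZero t ((shiftFunctor D n).map_isZero hE), mul_zero]
  · let H := σ.hnFiltration E hE
    rw [mass_eq t (hnShift H n), mass_eq t H, Finset.mul_sum]
    refine Finset.sum_congr rfl fun i _ => ?_
    change ‖σ.Z (K₀.cls ((H.A i)⟦n⟧))‖ * Real.exp ((H.φ i + n) * t) = _
    rw [K₀.norm_cls_shift, add_mul, Real.exp_add]
    ring

end StabilityCondition

/-! ### Complexity -/

/-- `E` is built from shifts `G⟦n i⟧` with `∑ i, exp (n i * t) = x`. -/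
inductive HasCost (t : ℝ) (G : D) : ℝ → D → Prop
  | zero {E : D} : IsZero E → HasCost t G 0 E
  | step {X E : D} {x : ℝ} (n : ℤ) : HasCost t G x X → Tri X E (G⟦n⟧) →
      HasCost t G (x + Real.exp (n * t)) E

namespace HasCost

variable {t : ℝ} {G : D}

theorem nonneg {x : ℝ} {E : D} (h : HasCost t G x E) : 0 ≤ x := by
  induction h with
  | zero => exact le_rfl
  | step n _ _ ih => positivity

theorem iso {x : ℝ} {E E' : D} (h : HasCost t G x E) (e : E ≅ E') : HasCost t G x E' := by
  cases h with
  | zero h => exact zero (h.of_iso e.symm)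
  | step n h h' => exact step n h (h'.iso (Iso.refl _) e.symm (Iso.refl _))

theorem of_isTower {k : ℕ} {n : Fin k → ℤ} {E : D} (h : IsTower (fun i => G⟦n i⟧) E) :
    HasCost t G (∑ i, Real.exp (n i * t)) E := by
  induction k generalizing E with
  | zero => simpa using zero (isTower_zero_iff.1 h)
  | succ k ih =>
    obtain ⟨X, hX, hE⟩ := isTower_succ_iff.1 h
    rw [Fin.sum_univ_castSucc]
    exact step _ (ih hX) hE

theorem exists_isTower {x : ℝ} {E : D} (h : HasCost t G x E) :
    ∃ (k : ℕ) (n : Fin k → ℤ), IsTower (fun i => G⟦n i⟧) E ∧ x = ∑ i, Real.exp (n i * t) := by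
  induction h with
  | zero h => exact ⟨0, Fin.elim0, isTower_zero_iff.2 h, by simp⟩
  | @step X _ _ n h h' ih =>
    obtain ⟨k, m, hm, rfl⟩ := ih
    refine ⟨k + 1, Fin.snoc (α := fun _ => ℤ) m n, isTower_succ_iff.2 ⟨X, ?_, ?_⟩, ?_⟩
    · simpa using hm
    · simpa using h'
    · simp [Fin.sum_univ_castSucc]

theorem shift {x : ℝ} {E : D} (h : HasCost t G x E) (m : ℤ) :
    HasCost t G (Real.exp (m * t) * x) (E⟦m⟧) := by
  induction h with
  | zero h =>
    rw [mul_zero]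
    exact zero ((shiftFunctor D m).map_isZero h)
  | step n h h' ih =>
    rw [mul_add, ← Real.exp_add, ← add_mul, add_comm (m : ℝ) n, ← Int.cast_add]
    exact step _ ih ((h'.shift m).iso (Iso.refl _) (Iso.refl _)
      ((shiftFunctorAdd D n m).app G))

theorem map (F : D ⥤ D) [F.CommShift ℤ] [F.IsTriangulated] {x : ℝ} {E : D}
    (h : HasCost t G x E) : HasCost t (F.obj G) x (F.obj E) := by
  induction h with
  | zero h => exact zero (F.map_isZero h)
  | step n h h' ih =>
    exact step n ih ((h'.map F).iso (Iso.refl _) (Iso.refl _) ((F.commShiftIso n).app G).symm)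

/-- Induction on the tower of `W`, whose last triangle is pulled back to `Y` by the octahedral
axiom. -/
theorem add [IsTriangulated D] {x y : ℝ} {X Y W : D} (hX : HasCost t G x X)
    (hW : HasCost t G y W) (h : Tri X Y W) : HasCost t G (x + y) Y := by
  induction hW generalizing Y with
  | zero hW =>
    rw [add_zero]
    exact hX.iso (h.nonempty_iso_of_isZero_right hW).some
  | step n _ h' ih =>
    obtain ⟨U, hU, hU'⟩ := h.comp' h'
    rw [← add_assoc]
    exact step n (ih hU) hU'

end HasCost

/-! ### Subadditivity, submultiplicativity and finiteness of complexity -/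

section Complexity

variable {t : ℝ} {G : D}

theorem complexity_eq (t : ℝ) (G E : D) :
    complexity t G E = ⨅ (x : ℝ) (E' : D) (_ : HasCost t G x (E ⊞ E')), ENNReal.ofReal x := by
  refine le_antisymm (le_iInf fun x => le_iInf fun E' => le_iInf fun h => ?_) (le_sInf ?_)
  · obtain ⟨k, n, hk, rfl⟩ := h.exists_isTower
    exact sInf_le ⟨k, n, E', hk, rfl⟩
  · rintro _ ⟨k, n, E', h, rfl⟩
    exact iInf_le_of_le _ (iInf_le_of_le E' (iInf_le _ (.of_isTower h)))

theorem HasCost.complexity_le {x : ℝ} {E E' : D} (h : HasCost t G x (E ⊞ E')) :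
    complexity t G E ≤ ENNReal.ofReal x := by
  rw [complexity_eq]
  exact iInf_le_of_le _ (iInf_le_of_le E' (iInf_le _ h))

theorem exists_hasCost_of_complexity_lt {E : D} {c : ℝ≥0∞} (h : complexity t G E < c) :
    ∃ x E', HasCost t G x (E ⊞ E') ∧ ENNReal.ofReal x < c := by
  rw [complexity_eq] at h
  simpa only [iInf_lt_iff, exists_prop] using h

theorem complexity_iso {E E' : D} (e : E ≅ E') : complexity t G E = complexity t G E' := by
  refine le_antisymm (le_of_forall_gt fun c hc => ?_) (le_of_forall_gt fun c hc => ?_)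
  · obtain ⟨x, A, h, hx⟩ := exists_hasCost_of_complexity_lt hc
    exact (h.iso (biprod.mapIso e.symm (Iso.refl A))).complexity_le.trans_lt hx
  · obtain ⟨x, A, h, hx⟩ := exists_hasCost_of_complexity_lt hc
    exact (h.iso (biprod.mapIso e (Iso.refl A))).complexity_le.trans_lt hx

theorem complexity_le_biprod (E E' : D) : complexity t G E ≤ complexity t G (E ⊞ E') := by
  refine le_of_forall_gt fun c hc => ?_
  obtain ⟨x, A, h, hx⟩ := exists_hasCost_of_complexity_lt hc
  exact (h.iso (biprod.associator _ _ _)).complexity_le.trans_lt hx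

theorem complexity_shift_le (m : ℤ) (E : D) :
    complexity t G (E⟦m⟧) ≤ ENNReal.ofReal (Real.exp (m * t)) * complexity t G E := by
  have := preservesBinaryBiproducts_of_preservesBinaryProducts (shiftFunctor D m)
  have h0 : ENNReal.ofReal (Real.exp (m * t)) ≠ 0 := by simp [Real.exp_pos]
  rw [mul_comm, ← ENNReal.div_le_iff h0 ENNReal.ofReal_ne_top]
  refine le_of_forall_gt fun c hc => ?_
  obtain ⟨x, A, h, hx⟩ := exists_hasCost_of_complexity_lt hc
  refine lt_of_le_of_lt ?_ hx
  rw [ENNReal.div_le_iff h0 ENNReal.ofReal_ne_top, mul_comm,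
    ← ENNReal.ofReal_mul (Real.exp_pos _).le]
  exact ((h.shift m).iso ((shiftFunctor D m).mapBiprod _ _)).complexity_le

theorem complexity_map_le (F : D ⥤ D) [F.CommShift ℤ] [F.IsTriangulated] (E : D) :
    complexity t (F.obj G) (F.obj E) ≤ complexity t G E := by
  have := preservesBinaryBiproducts_of_preservesBinaryProducts F
  refine le_of_forall_gt fun c hc => ?_
  obtain ⟨x, A, h, hx⟩ := exists_hasCost_of_complexity_lt hc
  exact ((h.map F).iso (F.mapBiprod _ _)).complexity_le.trans_lt hx

theorem complexity_self_le (t : ℝ) (G : D) : complexity t G G ≤ 1 := by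
  have h : HasCost t G (0 + Real.exp ((0 : ℤ) * t)) (G ⊞ 0) :=
    .step 0 (.zero (isZero_zero D)) (Tri.of_isZero_left
      ((isoBiprodZero (isZero_zero D)).symm ≪≫ ((shiftFunctorZero D ℤ).app G).symm)
      (isZero_zero D))
  simpa using h.complexity_le

variable [IsTriangulated D]

theorem complexity_le_add {X Y W : D} (h : Tri X Y W) :
    complexity t G Y ≤ complexity t G X + complexity t G W := by
  refine ENNReal.le_of_forall_pos_le_add fun ε hε hlt => ?_
  have hX := ENNReal.lt_add_right (a := complexity t G X) (b := ε / 2)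
    (by rintro h; simp [h] at hlt) (by simpa using hε.ne')
  have hW := ENNReal.lt_add_right (a := complexity t G W) (b := ε / 2)
    (by rintro h; simp [h] at hlt) (by simpa using hε.ne')
  obtain ⟨x, X', hx, hx'⟩ := exists_hasCost_of_complexity_lt hX
  obtain ⟨w, W', hw, hw'⟩ := exists_hasCost_of_complexity_lt hW
  refine ((hx.add hw (h.product (Tri.biprod X' W'))).complexity_le).trans ?_
  rw [ENNReal.ofReal_add hx.nonneg hw.nonneg]
  refine (add_le_add hx'.le hw'.le).trans (le_of_eq ?_)
  rw [add_add_add_comm, ENNReal.add_halves]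

theorem complexity_le_of_isTower {m : ℕ} {A : Fin m → D} {E : D} (h : IsTower A E) :
    complexity t G E ≤ ∑ i, complexity t G (A i) := by
  induction m generalizing E with
  | zero => simp [complexity_of_isZero t G E (isTower_zero_iff.1 h)]
  | succ m ih =>
    obtain ⟨X, hX, hE⟩ := isTower_succ_iff.1 h
    rw [Fin.sum_univ_castSucc]
    exact (complexity_le_add hE).trans (add_le_add (ih hX) le_rfl)

theorem HasCost.complexity_le_mul {G' : D} {x : ℝ} {M : D} (h : HasCost t G' x M) :
    complexity t G M ≤ ENNReal.ofReal x * complexity t G G' := by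
  induction h with
  | zero h => simp [complexity_of_isZero t G _ h]
  | step n h h' ih =>
    rw [ENNReal.ofReal_add h.nonneg (Real.exp_pos _).le, add_mul]
    exact (complexity_le_add h').trans (add_le_add ih (complexity_shift_le _ _))

/-- Each shift of `E₂` in a tower for `E₃` is replaced by its own tower over `E₁`. Finiteness
excludes the product `0 * ∞`. -/
theorem complexity_le_mul {E₁ E₂ E₃ : D} (h : complexity t E₁ E₂ ≠ ⊤)
    (h' : complexity t E₂ E₃ ≠ ⊤) :
    complexity t E₁ E₃ ≤ complexity t E₁ E₂ * complexity t E₂ E₃ := by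
  rw [mul_comm]
  refine ENNReal.le_mul_of_forall_lt (.inr h) (.inl h') fun a' ha b' hb => ?_
  obtain ⟨x, A, hx, hx'⟩ := exists_hasCost_of_complexity_lt ha
  refine (complexity_le_biprod _ A).trans (hx.complexity_le_mul.trans ?_)
  exact mul_le_mul' hx'.le hb.le

/-- Objects of finite complexity form a thick triangulated subcategory containing `G`. -/
theorem complexity_ne_top (hG : IsSplitGenerator G) (t : ℝ) (E : D) : complexity t G E ≠ ⊤ := by
  let Q : ObjectProperty D := fun E => complexity t G E ≠ ⊤
  have shiftQ (E : D) (m : ℤ) (h : Q E) : Q (E⟦m⟧) :=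
    ne_top_of_le_ne_top (ENNReal.mul_ne_top ENNReal.ofReal_ne_top h) (complexity_shift_le m E)
  have : Q.IsClosedUnderIsomorphisms := ⟨fun e h => by
    simp only [Q] at h ⊢
    rwa [← complexity_iso e]⟩
  have : Q.IsStableUnderRetracts := ⟨fun {X Y} r h => by
    obtain ⟨W, g, k, hT⟩ := distinguished_cocone_triangle r.i
    -- A monomorphism has zero connecting morphism, so a retract is a direct summand.
    have hk : k = 0 := (Triangle.mor₃_eq_zero_iff_mono₁ _ hT).2 (inferInstanceAs (Mono r.i))
    obtain ⟨e⟩ : Nonempty (Y ≅ X ⊞ W) :=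
      ⟨(exists_iso_binaryBiproduct_of_distTriang _ hT hk).choose⟩
    simp only [Q] at h ⊢
    rw [complexity_iso e] at h
    exact ne_top_of_le_ne_top h (complexity_le_biprod _ _)⟩
  have : Q.IsTriangulatedClosed₂ := .mk' fun T hT h₁ h₃ =>
    ne_top_of_le_ne_top (ENNReal.add_ne_top.2 ⟨h₁, h₃⟩) (complexity_le_add (Tri.of_mem hT))
  have : Q.IsStableUnderShift ℤ := ⟨fun a => ⟨fun X hX => shiftQ X a hX⟩⟩
  have : Q.ContainsZero := ⟨0, isZero_zero D, by
    simp [Q, complexity_of_isZero t G _ (isZero_zero D)]⟩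
  have : Q.IsTriangulated := { }
  have hle : ObjectProperty.singleton G ≤ Q := by
    intro X hX
    obtain rfl := (ObjectProperty.singleton_iff _ _).1 hX
    exact ne_top_of_le_ne_top ENNReal.one_ne_top (complexity_self_le t _)
  have := (ObjectProperty.triangEnvelope_le_iff _).2 hle
  rw [(ObjectProperty.isClassicalTriangulatedGenerator_iff _).1 hG] at this
  exact this E trivial

namespace StabilityCondition

variable {σ : StabilityCondition D}

theorem mass_le_of_hasCost {x : ℝ} {E : D} (h : HasCost t G x E) :
    σ.mass t E ≤ σ.mass t G * x := by
  induction h with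
  | zero h => rw [mass_of_isZero t h, mul_zero]
  | step n h h' ih =>
    refine (mass_le_add t h').trans ?_
    rw [mass_shift, mul_add, mul_comm (Real.exp _)]
    exact add_le_add ih le_rfl

/-- The `+ 1` keeps the constant positive when `G` has mass zero, so that one may divide by it. -/
theorem mass_le_mul_complexity (E : D) :
    ENNReal.ofReal (σ.mass t E) ≤ ENNReal.ofReal (σ.mass t G + 1) * complexity t G E := by
  have h0 : 0 < σ.mass t G + 1 := by linarith [mass_nonneg (σ := σ) t G]
  rw [mul_comm, ← ENNReal.div_le_iff (by simpa using h0) ENNReal.ofReal_ne_top]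
  refine le_of_forall_gt fun c hc => ?_
  obtain ⟨x, A, h, hx⟩ := exists_hasCost_of_complexity_lt hc
  refine lt_of_le_of_lt ?_ hx
  rw [ENNReal.div_le_iff (by simpa using h0) ENNReal.ofReal_ne_top, ← ENNReal.ofReal_mul h.nonneg]
  refine ENNReal.ofReal_le_ofReal ?_
  have h₁ := mass_le_of_hasCost (σ := σ) h
  rw [mass_biprod] at h₁
  nlinarith [mass_nonneg (σ := σ) t A, h.nonneg]

end StabilityCondition

end Complexity

variable [IsTriangulated D]

namespace StabilityCondition

variable {σ : StabilityCondition D}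

/-! ### The heart -/

omit [IsTriangulated D] in
theorem heart_of_isZero {E : D} (h : IsZero E) : σ.heart E := fun h' => absurd h h'

theorem heart_ext {X Y W : D} (h : Tri X Y W) (hX : σ.heart X) (hW : σ.heart W) : σ.heart Y := by
  rw [heart_iff] at *
  exact ⟨.ext h hX.1 hW.1, .ext h hX.2 hW.2⟩

instance : σ.heart.ContainsZero := ⟨0, isZero_zero D, heart_of_isZero (isZero_zero D)⟩

omit [IsTriangulated D] in
theorem isZero_heart {X : σ.heart.FullSubcategory} (h : IsZero X.obj) : IsZero X :=
  IsZero.of_full_of_faithful_of_isZero σ.heart.ι X h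

/-- The cone of a monomorphism of the heart lies in the heart. -/
theorem heart_cone {X Y : σ.heart.FullSubcategory} (f : X ⟶ Y) [Mono f] {W : D} {g : Y.obj ⟶ W}
    {k : W ⟶ X.obj⟦(1 : ℤ)⟧} (hT : Triangle.mk f.hom g k ∈ distTriang D) : σ.heart W := by
  have hX := heart_iff.1 X.property
  have hY := heart_iff.1 Y.property
  have hTri : Tri X.obj Y.obj W := ⟨_, _, _, hT⟩
  have hX1 : σ.le 2 (X.obj⟦(1 : ℤ)⟧) := le_mono (by norm_num) (le_shift_one hX.2)
  have hW0 : σ.gt 0 W := .ext hTri.rotate hY.1 (gt_mono (by norm_num) (gt_shift_one hX.1))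
  have hW2 : σ.le 2 W := .ext hTri.rotate (le_mono (by norm_num) hY.2) hX1
  obtain ⟨C, C', ⟨a, b, c, hC⟩, hC1, hC1'⟩ := σ.exists_truncation W 1
  have hCTri : Tri C W C' := ⟨_, _, _, hC⟩
  have hC2 : σ.le 2 C := .ext hCTri.invRotate (le_mono (by norm_num) (le_shift hC1' (-1))) hW2
  -- `A` plays the role of the kernel of `f`: its map to `X` is killed by `f`, hence zero. Then `a`
  -- lifts to `Y` and vanishes by comparing phases.
  let A : σ.heart.FullSubcategory := ⟨C⟦(-1 : ℤ)⟧, heart_iff.2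
    ⟨gt_mono (by norm_num) (gt_shift hC1 (-1)), le_mono (by norm_num) (le_shift hC2 (-1))⟩⟩
  let e : A.obj⟦(1 : ℤ)⟧ ≅ C := shiftNegShift C (1 : ℤ)
  obtain ⟨u, hu⟩ := (shiftFunctor D (1 : ℤ)).map_surjective (e.hom ≫ a ≫ k)
  have hkf : k ≫ f.hom⟦(1 : ℤ)⟧' = 0 := comp_distTriang_mor_zero₃₁ _ hT
  have hu0 : u ≫ f.hom = 0 := by
    apply (shiftFunctor D (1 : ℤ)).map_injective
    rw [Functor.map_comp, hu, Functor.map_zero, Category.assoc, Category.assoc, hkf, comp_zero,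
      comp_zero]
  have hu' : (ObjectProperty.homMk u : A ⟶ X) = 0 := by
    rw [← cancel_mono f, zero_comp]
    exact ObjectProperty.hom_ext _ hu0
  have hu0 : u = 0 := congrArg InducedCategory.Hom.hom hu'
  have hak : a ≫ k = 0 := by
    rw [← cancel_epi e.hom, ← hu, hu0, Functor.map_zero, comp_zero]
  obtain ⟨w, hw⟩ : ∃ w : C ⟶ Y.obj, a = w ≫ g := Triangle.coyoneda_exact₃ _ hT a hak
  have ha : a = 0 := by rw [hw, hom_gt_le hC1 hY.2 w, zero_comp]
  have hC0 : IsZero C := by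
    rw [IsZero.iff_id_eq_zero]
    refine Tri.eq_zero_of_comp_eq_zero hC
      (hom_gt_le (gt_mono (by norm_num) (gt_shift_one hC1)) hC1') ?_
    rw [ha, comp_zero]
  rw [heart_iff]
  exact ⟨hW0, hC1'.iso (hCTri.nonempty_iso_of_isZero_left hC0).some.symm⟩

theorem mono_of_heart_cone {X Y : σ.heart.FullSubcategory} (f : X ⟶ Y) {W : D} {g : Y.obj ⟶ W}
    {k : W ⟶ X.obj⟦(1 : ℤ)⟧} (hT : Triangle.mk f.hom g k ∈ distTriang D) (hW : σ.heart W) :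
    Mono f := by
  refine Preadditive.mono_of_cancel_zero f fun {A} u hu => ?_
  refine ObjectProperty.hom_ext _ ?_
  exact Tri.eq_zero_of_comp_eq_zero hT (hom_gt_le (θ := 1)
    (by simpa using gt_shift_one (heart_iff.1 A.property).1) (heart_iff.1 hW).2)
    (congrArg InducedCategory.Hom.hom hu)

/-! ### Finite length hearts and the bound of complexity by mass -/

variable (σ) in
/-- The simple objects of the heart. -/
def simpleObj : ObjectProperty D := fun E =>
  ∃ h : σ.heart E, Simple (⟨E, h⟩ : σ.heart.FullSubcategory)

/-- In a heart of finite length every object is an iterated extension of simple objects. -/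
theorem extClosure_simpleObj
    (hσ : ∀ X : σ.heart.FullSubcategory, IsNoetherianObject X ∧ IsArtinianObject X)
    (E : σ.heart.FullSubcategory) : ExtClosure σ.simpleObj E.obj := by
  have := (hσ E).1
  -- Take a maximal subobject among those filtered by simples; the zero subobject is one.
  obtain ⟨_, ⟨A, f, hf, rfl, hA⟩, hmax⟩ := (wellFounded_gt (α := Subobject E)).has_min
    {X | ∃ (A : σ.heart.FullSubcategory) (f : A ⟶ E) (_ : Mono f), X = Subobject.mk f ∧
      ExtClosure σ.simpleObj A.obj}
    ⟨_, ⟨0, heart_of_isZero (isZero_zero D)⟩, 0,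
      (isZero_heart (isZero_zero D)).mono _, rfl, .zero (isZero_zero D)⟩
  obtain ⟨W, g, k, hT⟩ := distinguished_cocone_triangle f.hom
  have hW := heart_cone f hT
  have hTri : Tri A.obj E.obj W := ⟨_, _, _, hT⟩
  by_cases hW0 : IsZero W
  · exact hA.iso (hTri.nonempty_iso_of_isZero_right hW0).some
  exfalso
  have := (hσ ⟨W, hW⟩).2
  obtain ⟨Y, hY⟩ := exists_simple_subobject (X := (⟨W, hW⟩ : σ.heart.FullSubcategory))
    fun h => hW0 (σ.heart.ι.map_isZero h)
  obtain ⟨R, r, r', hR⟩ := distinguished_cocone_triangle Y.arrow.hom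
  have hR' := heart_cone Y.arrow hR
  -- `U` is the preimage in `E` of a simple subobject of the quotient `W`. Maximality forces `U =
  -- A`, so the simple would be zero.
  obtain ⟨U, p, q, hU⟩ := distinguished_cocone_triangle₁ (g ≫ r)
  let o := Triangulated.someOctahedron' rfl hT hR hU
  have hAU : Tri A.obj U (Y : σ.heart.FullSubcategory).obj := ⟨_, _, _, o.mem⟩
  let U' : σ.heart.FullSubcategory :=
    ⟨U, heart_ext hAU A.property (Y : σ.heart.FullSubcategory).property⟩
  let p' : U' ⟶ E := ObjectProperty.homMk p
  have : Mono p' := mono_of_heart_cone p' hU hR'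
  let m : A ⟶ U' := ObjectProperty.homMk o.m₁
  have hm : m ≫ p' = f := ObjectProperty.hom_ext _ o.comm₁
  have hle : Subobject.mk f ≤ Subobject.mk p' := Subobject.mk_le_mk_of_comm m hm
  have hge : Subobject.mk p' ≤ Subobject.mk f := by
    by_contra hge
    exact hmax _ ⟨U', p', inferInstance, rfl, .ext hAU hA (.of ⟨_, hY⟩)⟩ (lt_of_le_not_ge hle hge)
  let n := Subobject.ofMkLEMk p' f hge
  have hn : n ≫ f = p' := Subobject.ofMkLEMk_comp hge
  have hmn : m ≫ n = 𝟙 A := by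
    rw [← cancel_mono f, Category.assoc, hn, hm, Category.id_comp]
  have hnm : n ≫ m = 𝟙 U' := by
    rw [← cancel_mono p', Category.assoc, hm, hn, Category.id_comp]
  have hiso : IsIso o.m₁ := ⟨n.hom, congrArg InducedCategory.Hom.hom hmn,
    congrArg InducedCategory.Hom.hom hnm⟩
  have hY0 : IsZero (Y : σ.heart.FullSubcategory).obj :=
    (Triangle.isZero₃_iff_isIso₁ _ o.mem).2 hiso
  exact Simple.not_isZero _ (isZero_heart hY0)

theorem exists_complexity_le_rotIm {G : D} (hG : IsSplitGenerator G) (hσ : σ.IsAlgebraic) (t : ℝ) :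
    ∃ θ C : ℝ, 0 ≤ C ∧ ∀ E, σ.heart E →
      complexity t G E ≤ ENNReal.ofReal (C * rotIm θ (σ.Z (K₀.cls E))) := by
  obtain ⟨hlen, s, hs, hsimple⟩ := hσ
  -- Without rotation the imaginary part vanishes on simples of phase `1`. A small `θ > 0`, below
  -- all phases of the finitely many representatives, makes it positive on every simple.
  have hev : ∀ᶠ θ : ℝ in 𝓝[>] 0, ∀ Y ∈ s, σ.gt θ Y.obj := by
    rw [Filter.eventually_all_finite hs]
    intro Y _
    by_cases hY : IsZero Y.obj
    · exact .of_forall fun θ => .zero hY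
    · have hpos := (Y.property hY).2.1
      filter_upwards [Ioo_mem_nhdsGT hpos] with θ hθ
      exact gt_of_hn _ hθ.2
  obtain ⟨θ, hθ, hθ0⟩ := (hev.and self_mem_nhdsWithin).exists
  replace hθ0 : 0 < θ := hθ0
  have hpos {E : D} (h : σ.gt θ E) (h' : σ.heart E) (hE : ¬ IsZero E) :
      0 < rotIm θ (σ.Z (K₀.cls E)) := by
    let H := σ.hnFiltration E hE
    rw [K₀.cls_of_isTower H.tower, map_sum, map_sum]
    refine Finset.sum_pos (fun i _ => ?_) Finset.univ_nonempty
    rw [rotIm_charge θ (H.mem i) (H.not_isZero i)]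
    have h₁ := lt_phi_of_gt H h i
    have h₂ := phi_le_of_le H (heart_iff.1 h').2 i
    refine mul_pos (norm_charge_pos (H.mem i) (H.not_isZero i)) (Real.sin_pos_of_pos_of_lt_pi ?_ ?_)
    · exact mul_pos Real.pi_pos (by linarith)
    · nlinarith [Real.pi_pos]
  obtain ⟨C, hC⟩ := (hs.image fun Y =>
    (complexity t G Y.obj).toReal / rotIm θ (σ.Z (K₀.cls Y.obj))).bddAbove
  refine ⟨θ, max C 0, le_max_right _ _, fun E hE => ?_⟩
  suffices H : ExtClosure σ.simpleObj E → 0 ≤ rotIm θ (σ.Z (K₀.cls E)) ∧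
      complexity t G E ≤ ENNReal.ofReal (max C 0 * rotIm θ (σ.Z (K₀.cls E))) from
    (H (extClosure_simpleObj hlen ⟨E, hE⟩)).2
  intro h
  clear hE
  induction h with
  | zero h => simp [K₀.cls_of_isZero h, complexity_of_isZero t G _ h]
  | @of X h =>
    obtain ⟨hX, hX'⟩ := h
    obtain ⟨Y, hY, ⟨e'⟩⟩ := hsimple _ hX'
    obtain ⟨e⟩ : Nonempty (X ≅ Y.obj) := ⟨σ.heart.ι.mapIso e'⟩
    have hY0 : ¬ IsZero Y.obj := fun h0 =>
      Simple.not_isZero (⟨_, hX⟩ : σ.heart.FullSubcategory) (isZero_heart (h0.of_iso e))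
    have hp := hpos (hθ Y hY) Y.property hY0
    rw [K₀.cls_of_iso e, complexity_iso e]
    refine ⟨hp.le, ?_⟩
    rw [← ENNReal.ofReal_toReal (complexity_ne_top hG t _)]
    refine ENNReal.ofReal_le_ofReal ?_
    rw [← div_le_iff₀ hp]
    exact (hC ⟨Y, hY, rfl⟩).trans (le_max_left _ _)
  | ext h _ _ h₁ h₂ =>
    rw [K₀.cls_of_tri h, map_add, map_add]
    refine ⟨add_nonneg h₁.1 h₂.1, (complexity_le_add h).trans ?_⟩
    rw [mul_add, ENNReal.ofReal_add (mul_nonneg (le_max_right _ _) h₁.1)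
      (mul_nonneg (le_max_right _ _) h₂.1)]
    exact add_le_add h₁.2 h₂.2

theorem rotIm_le_norm (θ : ℝ) (z : ℂ) : rotIm θ z ≤ ‖z‖ := by
  refine (Complex.im_le_norm _).trans (le_of_eq ?_)
  change ‖Complex.exp (-(Real.pi * θ * Complex.I)) * z‖ = ‖z‖
  rw [norm_mul, show -(Real.pi * θ * Complex.I : ℂ) = ((-(Real.pi * θ) : ℝ) : ℂ) * Complex.I by
    push_cast; ring, Complex.norm_exp_ofReal_mul_I, one_mul]

theorem IsAlgebraic.exists_complexity_le_mass {G : D} (hG : IsSplitGenerator G)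
    (hσ : σ.IsAlgebraic) (t : ℝ) :
    ∃ C : ℝ, 0 < C ∧ ∀ E, complexity t G E ≤ ENNReal.ofReal (C * σ.mass t E) := by
  obtain ⟨θ, C, hC0, hC⟩ := exists_complexity_le_rotIm hG hσ t
  have key {φ : ℝ} {A : D} (hA : σ.P φ A) : complexity t G A ≤
      ENNReal.ofReal ((C + 1) * Real.exp |t| * (‖σ.Z (K₀.cls A)‖ * Real.exp (φ * t))) := by
    -- This choice puts `φ - n` in `(0, 1]`, so `A⟦-n⟧` lies in the heart.
    set n : ℤ := ⌈φ⌉ - 1 with hn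
    have hφ₁ : φ ≤ n + 1 := by rw [hn]; push_cast; linarith [Int.le_ceil φ]
    have hφ₂ : (n : ℝ) < φ := by rw [hn]; push_cast; linarith [Int.ceil_lt_add_one φ]
    have hB := P_shift hA (-n)
    have hB' : σ.heart (A⟦-n⟧) := heart_iff.2
      ⟨gt_of_P (by push_cast; linarith) hB, le_of_P (by push_cast; linarith) hB⟩
    rw [← complexity_iso (shiftNegShift A n)]
    refine (complexity_shift_le n _).trans ?_
    refine (mul_le_mul' le_rfl (hC _ hB')).trans ?_
    rw [← ENNReal.ofReal_mul (Real.exp_pos _).le]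
    refine ENNReal.ofReal_le_ofReal ?_
    have h₁ : Real.exp (n * t) ≤ Real.exp |t| * Real.exp (φ * t) := by
      rw [← Real.exp_add, Real.exp_le_exp]
      have : (n - φ) * t ≤ |t| := by
        refine (le_abs_self _).trans ?_
        rw [abs_mul]
        refine mul_le_of_le_one_left (abs_nonneg _) (abs_le.2 ⟨by linarith, by linarith⟩)
      linarith
    have h₂ : C * rotIm θ (σ.Z (K₀.cls (A⟦-n⟧))) ≤ (C + 1) * ‖σ.Z (K₀.cls A)‖ := by
      have := rotIm_le_norm θ (σ.Z (K₀.cls (A⟦-n⟧)))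
      rw [K₀.norm_cls_shift] at this
      nlinarith [norm_nonneg (σ.Z (K₀.cls A))]
    calc _ ≤ Real.exp (n * t) * ((C + 1) * ‖σ.Z (K₀.cls A)‖) :=
          mul_le_mul_of_nonneg_left h₂ (Real.exp_pos _).le
      _ ≤ (Real.exp |t| * Real.exp (φ * t)) * ((C + 1) * ‖σ.Z (K₀.cls A)‖) :=
          mul_le_mul_of_nonneg_right h₁ (by positivity)
      _ = _ := by ring
  refine ⟨(C + 1) * Real.exp |t|, by positivity, fun E => ?_⟩
  by_cases hE : IsZero E
  · simp [complexity_of_isZero t G E hE]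
  · let H := σ.hnFiltration E hE
    rw [mass_eq t H, Finset.mul_sum, ENNReal.ofReal_sum_of_nonneg fun i _ => by positivity]
    exact (complexity_le_of_isTower H.tower).trans (Finset.sum_le_sum fun i _ => key (H.mem i))

end StabilityCondition

namespace StabilityCondition

/-! ### Comparison of masses -/

variable {σ τ : StabilityCondition D} {t : ℝ}

/-- The `τ`-mass is subadditive along a `σ`-filtration, whereas the `σ`-mass is exactly the sum over
its factors. -/
theorem mass_le_mul_of_semistable {C : ℝ}
    (h : ∀ φ E, σ.P φ E → ¬ IsZero E → τ.mass t E ≤ C * σ.mass t E) (E : D) :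
    τ.mass t E ≤ C * σ.mass t E := by
  by_cases hE : IsZero E
  · simp [mass_of_isZero t hE]
  · let H := σ.hnFiltration E hE
    refine (mass_le_of_isTower t H.tower).trans ?_
    rw [mass_eq t H, Finset.mul_sum]
    refine Finset.sum_le_sum fun i _ => ?_
    rw [← mass_of_P t (H.mem i) (H.not_isZero i)]
    exact h _ _ (H.mem i) (H.not_isZero i)

omit [IsTriangulated D] in
theorem abs_phi_sub_le {E : D} (hE : ¬ IsZero E) {φ ε : ℝ} (h₁ : |φ - σ.phiMinus E hE| ≤ ε)
    (h₂ : |φ - σ.phiPlus E hE| ≤ ε) (i) : |(σ.hnFiltration E hE).φ i - φ| ≤ ε := by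
  have h₃ := phi_le (σ.hnFiltration E hE) i
  have h₄ := le_phi (σ.hnFiltration E hE) i
  rw [abs_le] at *
  rw [phiMinus] at h₁
  rw [phiPlus] at h₂
  constructor <;> linarith

omit [IsTriangulated D] in
-- Project to the direction of phase `φ`: charges in a sector of half-angle `π * ε` around it cannot
-- cancel.
theorem sum_norm_mul_cos_le {E : D} (H : HNFiltration σ.P E) {φ ε : ℝ} (hε : ε ≤ 1)
    (h : ∀ i, |H.φ i - φ| ≤ ε) :
    (∑ i, ‖σ.Z (K₀.cls (H.A i))‖) * Real.cos (Real.pi * ε) ≤ ‖σ.Z (K₀.cls E)‖ := by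
  refine le_trans ?_ (rotIm_le_norm (φ - 1 / 2) _)
  rw [K₀.cls_of_isTower H.tower, map_sum, map_sum, Finset.sum_mul]
  refine Finset.sum_le_sum fun i _ => ?_
  rw [rotIm_charge _ (H.mem i) (H.not_isZero i)]
  refine mul_le_mul_of_nonneg_left ?_ (norm_nonneg _)
  have hsin : Real.sin (Real.pi * (H.φ i - (φ - 1 / 2))) = Real.cos (Real.pi * |H.φ i - φ|) := by
    rw [show Real.pi * |H.φ i - φ| = |Real.pi * (H.φ i - φ)| by
      rw [abs_mul, abs_of_pos Real.pi_pos], Real.cos_abs, ← Real.sin_add_pi_div_two]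
    ring_nf
  rw [hsin]
  refine Real.cos_le_cos_of_nonneg_of_le_pi ?_ ?_ ?_
  · exact mul_nonneg Real.pi_pos.le (abs_nonneg _)
  · nlinarith [Real.pi_pos]
  · exact mul_le_mul_of_nonneg_left (h i) Real.pi_pos.le

theorem mass_le_sum_norm {E : D} (H : HNFiltration σ.P E) {φ ε : ℝ} (hε : ε ≤ 1)
    (h : ∀ i, |H.φ i - φ| ≤ ε) :
    σ.mass t E ≤ Real.exp |t| * Real.exp (φ * t) * ∑ i, ‖σ.Z (K₀.cls (H.A i))‖ := by
  rw [mass_eq t H, Finset.mul_sum]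
  refine Finset.sum_le_sum fun i _ => ?_
  rw [mul_comm]
  refine mul_le_mul_of_nonneg_right ?_ (norm_nonneg _)
  rw [← Real.exp_add, Real.exp_le_exp]
  have : (H.φ i - φ) * t ≤ |t| := by
    refine (le_abs_self _).trans ?_
    rw [abs_mul]
    exact mul_le_of_le_one_left (abs_nonneg _) ((h i).trans hε)
  linarith

omit [IsTriangulated D] in
theorem abs_phi_sub_lt_of_mem_basicOpen {ε : ℝ} (hε : 0 < ε) (h : τ ∈ σ.basicOpen ε) {E : D}
    (hE : ¬ IsZero E) : |σ.phiMinus E hE - τ.phiMinus E hE| < ε ∧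
      |σ.phiPlus E hE - τ.phiPlus E hE| < ε := by
  have h₁ : max (ENNReal.ofReal |σ.phiMinus E hE - τ.phiMinus E hE|)
      (ENNReal.ofReal |σ.phiPlus E hE - τ.phiPlus E hE|) < ENNReal.ofReal ε :=
    (le_iSup₂ (f := fun (E : D) (hE : ¬ IsZero E) =>
      max (ENNReal.ofReal |σ.phiMinus E hE - τ.phiMinus E hE|)
      (ENNReal.ofReal |σ.phiPlus E hE - τ.phiPlus E hE|)) E hE).trans_lt h.1
  rw [max_lt_iff, ENNReal.ofReal_lt_ofReal_iff hε, ENNReal.ofReal_lt_ofReal_iff hε] at h₁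
  exact h₁

omit [IsTriangulated D] in
theorem norm_charge_sub_le_of_mem_basicOpen {ε : ℝ} (h : τ ∈ σ.basicOpen ε) (hε : 0 < ε)
    (hε' : ε < 1) {φ : ℝ} {E : D} (hP : σ.P φ E) (hE : ¬ IsZero E) :
    ‖σ.Z (K₀.cls E) - τ.Z (K₀.cls E)‖ ≤ Real.sin (Real.pi * ε) * ‖σ.Z (K₀.cls E)‖ := by
  have h₁ : ENNReal.ofReal (‖σ.Z (K₀.cls E) - τ.Z (K₀.cls E)‖ / ‖σ.Z (K₀.cls E)‖) <
      ENNReal.ofReal (Real.sin (Real.pi * ε)) :=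
    lt_of_le_of_lt (by
      rw [chargeDist]
      exact le_iSup₂_of_le φ E (le_iSup₂_of_le hP hE le_rfl)) h.2
  rw [ENNReal.ofReal_lt_ofReal_iff (Real.sin_pos_of_pos_of_lt_pi (by positivity)
    (by nlinarith [Real.pi_pos])), div_lt_iff₀ (norm_charge_pos hP hE)] at h₁
  exact h₁.le

theorem phiPlus_of_P {φ : ℝ} {E : D} (h : σ.P φ E) (hE : ¬ IsZero E) : σ.phiPlus E hE = φ :=
  phi_eq_of_P _ h _

theorem phiMinus_of_P {φ : ℝ} {E : D} (h : σ.P φ E) (hE : ¬ IsZero E) : σ.phiMinus E hE = φ :=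
  phi_eq_of_P _ h _

theorem exists_mass_le_of_mem_basicOpen {ε : ℝ} (hε : 0 < ε) (hε' : ε < 1 / 4)
    (h : τ ∈ σ.basicOpen ε) (t : ℝ) : ∃ C, 0 < C ∧ ∀ E, τ.mass t E ≤ C * σ.mass t E := by
  have hcos : 0 < Real.cos (Real.pi * ε) := Real.cos_pos_of_mem_Ioo
    ⟨by nlinarith [Real.pi_pos], by nlinarith [Real.pi_pos]⟩
  have hsin : 0 < Real.sin (Real.pi * ε) := Real.sin_pos_of_pos_of_lt_pi (by positivity)
    (by nlinarith [Real.pi_pos])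
  refine ⟨Real.exp |t| * ((1 + Real.sin (Real.pi * ε)) / Real.cos (Real.pi * ε)), by positivity,
    mass_le_mul_of_semistable fun φ E hP hE => ?_⟩
  have hph := abs_phi_sub_lt_of_mem_basicOpen hε h hE
  rw [phiPlus_of_P hP, phiMinus_of_P hP] at hph
  have hphi := abs_phi_sub_le hE hph.1.le hph.2.le
  have h₁ := sum_norm_mul_cos_le _ (by linarith) hphi
  have h₂ := norm_charge_sub_le_of_mem_basicOpen h hε (by linarith) hP hE
  have h₃ := norm_sub_norm_le (τ.Z (K₀.cls E)) (σ.Z (K₀.cls E))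
  rw [norm_sub_rev] at h₃
  refine (mass_le_sum_norm _ (by linarith) hphi).trans ?_
  rw [mass_of_P t hP hE]
  have h₄ : ‖τ.Z (K₀.cls E)‖ ≤ (1 + Real.sin (Real.pi * ε)) * ‖σ.Z (K₀.cls E)‖ := by linarith
  refine (mul_le_mul_of_nonneg_left ((le_div_iff₀ hcos).2 (h₁.trans h₄))
    (by positivity)).trans (le_of_eq ?_)
  ring

/-- The charge estimate is only available on the `σ`-factors of a `τ`-semistable object, so its
error `sin (π * ε)` must be absorbed into `cos (π * ε)`. This is where `ε < 1 / 4` is needed. -/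
theorem exists_mass_le_of_mem_basicOpen' {ε : ℝ} (hε : 0 < ε) (hε' : ε < 1 / 4)
    (h : τ ∈ σ.basicOpen ε) (t : ℝ) : ∃ C, 0 < C ∧ ∀ E, σ.mass t E ≤ C * τ.mass t E := by
  have hcs : Real.sin (Real.pi * ε) < Real.cos (Real.pi * ε) := by
    rw [← Real.sin_pi_div_two_sub]
    exact Real.sin_lt_sin_of_lt_of_le_pi_div_two (by nlinarith [Real.pi_pos])
      (by nlinarith [Real.pi_pos]) (by nlinarith [Real.pi_pos])
  have hpos : 0 < Real.cos (Real.pi * ε) - Real.sin (Real.pi * ε) := by linarith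
  refine ⟨Real.exp |t| * (Real.cos (Real.pi * ε) - Real.sin (Real.pi * ε))⁻¹, by positivity,
    mass_le_mul_of_semistable fun φ E hP hE => ?_⟩
  have hph := abs_phi_sub_lt_of_mem_basicOpen hε h hE
  rw [phiPlus_of_P hP, phiMinus_of_P hP, abs_sub_comm, abs_sub_comm _ φ] at hph
  have hphi := abs_phi_sub_le hE hph.1.le hph.2.le
  set H := σ.hnFiltration E hE
  have h₁ := sum_norm_mul_cos_le _ (by linarith) hphi
  have h₂ : ‖σ.Z (K₀.cls E) - τ.Z (K₀.cls E)‖ ≤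
      Real.sin (Real.pi * ε) * ∑ i, ‖σ.Z (K₀.cls (H.A i))‖ := by
    rw [K₀.cls_of_isTower H.tower, map_sum, map_sum, ← Finset.sum_sub_distrib, Finset.mul_sum]
    exact (norm_sum_le _ _).trans (Finset.sum_le_sum fun i _ =>
      norm_charge_sub_le_of_mem_basicOpen h hε (by linarith) (H.mem i) (H.not_isZero i))
  have h₃ := norm_sub_norm_le (σ.Z (K₀.cls E)) (τ.Z (K₀.cls E))
  refine (mass_le_sum_norm _ (by linarith) hphi).trans ?_
  rw [mass_of_P t hP hE]
  have h₄ : ∑ i, ‖σ.Z (K₀.cls (H.A i))‖ ≤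
      (Real.cos (Real.pi * ε) - Real.sin (Real.pi * ε))⁻¹ * ‖τ.Z (K₀.cls E)‖ := by
    rw [← div_eq_inv_mul, le_div_iff₀ hpos]
    linarith
  refine (mul_le_mul_of_nonneg_left h₄ (by positivity)).trans (le_of_eq ?_)
  ring

omit [IsTriangulated D] in
theorem mem_basicOpen_self (σ : StabilityCondition D) {ε : ℝ} (hε : 0 < ε) (hε' : ε < 1) :
    σ ∈ σ.basicOpen ε := by
  have hsin : 0 < Real.sin (Real.pi * ε) := Real.sin_pos_of_pos_of_lt_pi (by positivity)
    (by nlinarith [Real.pi_pos])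
  constructor
  · simpa [slicingDist] using hε
  · simpa [chargeDist] using hsin

/-- Masses of stability conditions in the same connected component are equivalent. -/
theorem exists_mass_le_of_mem_connectedComponent {σ₀ σ : StabilityCondition D}
    (h : σ ∈ connectedComponent σ₀) (t : ℝ) :
    (∃ C, 0 < C ∧ ∀ E, σ.mass t E ≤ C * σ₀.mass t E) ∧
      ∃ C, 0 < C ∧ ∀ E, σ₀.mass t E ≤ C * σ.mass t E := by
  let R (σ τ : StabilityCondition D) : Prop := ∃ C, 0 < C ∧ ∀ E, τ.mass t E ≤ C * σ.mass t E
  have trans {σ₁ σ₂ σ₃ : StabilityCondition D} (h : R σ₁ σ₂) (h' : R σ₂ σ₃) : R σ₁ σ₃ := by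
    obtain ⟨C, hC, h⟩ := h
    obtain ⟨C', hC', h'⟩ := h'
    refine ⟨C' * C, by positivity, fun E => (h' E).trans ?_⟩
    rw [mul_assoc]
    exact mul_le_mul_of_nonneg_left (h E) hC'.le
  have refl (σ : StabilityCondition D) : R σ σ := ⟨1, one_pos, fun E => (one_mul _).ge⟩
  let U : Set (StabilityCondition D) := {τ | R σ₀ τ ∧ R τ σ₀}
  have hnhds (σ : StabilityCondition D) : ∀ᶠ τ in 𝓝 σ, R σ τ ∧ R τ σ := by
    have hopen : IsOpen (σ.basicOpen (1 / 8)) :=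
      .basic _ ⟨σ, 1 / 8, by norm_num, by norm_num, rfl⟩
    filter_upwards [hopen.mem_nhds (σ.mem_basicOpen_self (by norm_num) (by norm_num))] with τ hτ
    exact ⟨exists_mass_le_of_mem_basicOpen (by norm_num) (by norm_num) hτ t,
      exists_mass_le_of_mem_basicOpen' (by norm_num) (by norm_num) hτ t⟩
  -- Each point has a neighbourhood of stability conditions comparable with it, so both the class of
  -- `σ₀` and its complement are open.
  have hU : IsClopen U := by
    constructor
    · rw [← isOpen_compl_iff, isOpen_iff_mem_nhds]
      intro τ hτ
      filter_upwards [hnhds τ] with τ' hτ' hmem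
      exact hτ ⟨trans hmem.1 hτ'.2, trans hτ'.1 hmem.2⟩
    · rw [isOpen_iff_mem_nhds]
      intro τ hτ
      filter_upwards [hnhds τ] with τ' hτ'
      exact ⟨trans hτ.1 hτ'.1, trans hτ'.2 hτ.2⟩
  exact hU.connectedComponent_subset (show σ₀ ∈ U from ⟨refl _, refl _⟩) h

end StabilityCondition

/-! ### Growth rates -/

/-- Fekete's lemma for submultiplicative sequences, with a limit in `[-∞, ∞]`. -/
theorem exists_tendsto_log_div {a : ℕ → ℝ≥0∞} (ha : ∀ n, a n ≠ ⊤)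
    (hmul : ∀ m n, a (m + n) ≤ a m * a n) :
    ∃ L : EReal, Tendsto (fun n : ℕ => ENNReal.log (a n) / (n : EReal)) atTop (𝓝 L) := by
  by_cases h0 : ∃ N, a N = 0
  · obtain ⟨N, hN⟩ := h0
    -- One zero value forces all later values to vanish.
    refine ⟨⊥, tendsto_const_nhds.congr' ?_⟩
    filter_upwards [eventually_ge_atTop N, eventually_gt_atTop 0] with n hn hn0
    have : a n = 0 := by
      obtain ⟨k, rfl⟩ := Nat.exists_eq_add_of_le hn
      simpa [hN] using hmul N k
    rw [this, ENNReal.log_zero, EReal.bot_div_of_pos_ne_top (by exact_mod_cast hn0)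
      (EReal.natCast_ne_top n)]
  push Not at h0
  let u : ℕ → ℝ := fun n => Real.log (a n).toReal
  have hpos (n) : 0 < (a n).toReal := ENNReal.toReal_pos (h0 n) (ha n)
  have hu (n : ℕ) : ENNReal.log (a n) / (n : EReal) = ((u n / n : ℝ) : EReal) := by
    rw [EReal.coe_div, ENNReal.log_pos_real (h0 n) (ha n), EReal.coe_natCast]
  have hsub : Subadditive u := fun m n => by
    rw [← Real.log_mul (hpos m).ne' (hpos n).ne', ← ENNReal.toReal_mul]
    exact Real.log_le_log (hpos _) (ENNReal.toReal_mono (ENNReal.mul_ne_top (ha m) (ha n))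
      (hmul m n))
  simp only [hu]
  by_cases hb : BddBelow (Set.range fun n => u n / n)
  · exact ⟨_, EReal.tendsto_coe.2 (hsub.tendsto_lim hb)⟩
  · refine ⟨⊥, EReal.tendsto_nhds_bot_iff_real.2 fun x => ?_⟩
    -- The `min` with `0` excludes `n = 0`, where the quotient is `0` by convention.
    obtain ⟨_, ⟨n, rfl⟩, hn⟩ := not_bddBelow_iff.1 hb (min x 0)
    have hn0 : n ≠ 0 := by
      rintro rfl
      simp at hn
    filter_upwards [hsub.eventually_div_lt_of_div_lt hn0 (hn.trans_le (min_le_left _ _))] with p hp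
    exact_mod_cast hp

theorem log_div_le {C : ℝ} (hC : 0 < C) {x y : ℝ≥0∞} (h : x ≤ ENNReal.ofReal C * y) (n : ℕ) :
    ENNReal.log x / (n : EReal) ≤ ((Real.log C / n : ℝ) : EReal) + ENNReal.log y / (n : EReal) := by
  have hn : (0 : EReal) ≤ n := by exact_mod_cast n.zero_le
  refine (EReal.div_le_div_right_of_nonneg hn (ENNReal.log_monotone h)).trans (le_of_eq ?_)
  rw [ENNReal.log_mul_add, EReal.add_div_of_nonneg_right hn, ENNReal.log_ofReal_of_pos hC,
    EReal.coe_div, EReal.coe_natCast]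

/-- Addition on `EReal` is continuous at `(0, L)` even for infinite `L`, because `0` is finite. -/
theorem tendsto_div_add {c : ℝ} {f : ℕ → EReal} {L : EReal} (h : Tendsto f atTop (𝓝 L)) :
    Tendsto (fun n : ℕ => ((c / n : ℝ) : EReal) + f n) atTop (𝓝 L) := by
  have h₁ : Tendsto (fun n : ℕ => ((c / n : ℝ) : EReal)) atTop (𝓝 ((0 : ℝ) : EReal)) :=
    EReal.tendsto_coe.2 (tendsto_const_div_atTop_nhds_zero_nat c)
  have h₂ := (EReal.continuousAt_add (p := (((0 : ℝ) : EReal), L)) (.inl (EReal.coe_ne_top _))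
    (.inl (EReal.coe_ne_bot _))).tendsto.comp (h₁.prodMk_nhds h)
  simpa [Function.comp_def] using h₂

section Iterate

variable (F : D ⥤ D) [F.CommShift ℤ] [F.IsTriangulated] {t : ℝ} {G : D}

omit [IsTriangulated D] in
theorem complexity_iterate_le (n : ℕ) (E : D) :
    complexity t (F.obj^[n] G) (F.obj^[n] E) ≤ complexity t G E := by
  induction n with
  | zero => exact le_rfl
  | succ n ih =>
    rw [Function.iterate_succ_apply', Function.iterate_succ_apply']
    exact (complexity_map_le F _).trans ih

/-- Pass through `Fⁿ G`: applying `Fⁿ` to a tower from `G` to `E` gives one of the same cost from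
`Fⁿ G` to `Fⁿ E`. -/
theorem complexity_le_iterate_mul (hG : IsSplitGenerator G) (n : ℕ) (E : D) :
    complexity t G (F.obj^[n] E) ≤ complexity t G (F.obj^[n] G) * complexity t G E := by
  have h := complexity_iterate_le F (t := t) (G := G) n E
  have hE := complexity_ne_top hG t E
  exact (complexity_le_mul (complexity_ne_top hG t _) (ne_top_of_le_ne_top hE h)).trans
    (mul_le_mul' le_rfl h)

theorem exists_tendsto_entropySeq (hG : IsSplitGenerator G) (t : ℝ) :
    ∃ L, Tendsto (entropySeq G F t) atTop (𝓝 L) :=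
  exists_tendsto_log_div (a := fun n => complexity t G (F.obj^[n] G))
    (fun _ => complexity_ne_top hG t _) fun m n => by
      rw [Function.iterate_add_apply]
      exact complexity_le_iterate_mul F hG m _

theorem StabilityCondition.exists_mass_le_complexity (σ : StabilityCondition D)
    (hG : IsSplitGenerator G) (t : ℝ) (E : D) : ∃ C : ℝ, 0 < C ∧ ∀ n,
      ENNReal.ofReal (σ.mass t (F.obj^[n] E)) ≤
        ENNReal.ofReal C * complexity t G (F.obj^[n] G) := by
  have h0 : 0 < σ.mass t G + 1 := by linarith [mass_nonneg (σ := σ) t G]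
  have h1 : 0 < (complexity t G E).toReal + 1 := by positivity
  refine ⟨(σ.mass t G + 1) * ((complexity t G E).toReal + 1), by positivity, fun n => ?_⟩
  refine (mass_le_mul_complexity (G := G) _).trans ?_
  rw [ENNReal.ofReal_mul h0.le, mul_assoc,
    mul_comm (ENNReal.ofReal ((complexity t G E).toReal + 1))]
  refine mul_le_mul' le_rfl ((complexity_le_iterate_mul F hG n E).trans (mul_le_mul' le_rfl ?_))
  rw [← ENNReal.ofReal_toReal (complexity_ne_top hG t E)]
  exact ENNReal.ofReal_le_ofReal (by simp)

end Iterate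

end MassGrowth

end

/-! ### Entropy equals mass growth -/

theorem theorem3p16 {D : Type u} [Category.{v} D] [Preadditive D] [HasZeroObject D]
    [HasShift D ℤ] [∀ n : ℤ, (shiftFunctor D n).Additive] [Pretriangulated D] [IsTriangulated D]
    [Module.Free ℤ (MassGrowth.K₀ D)] [Module.Finite ℤ (MassGrowth.K₀ D)]
    (G : D) (hG : MassGrowth.IsSplitGenerator G)
    (F : D ⥤ D) [F.CommShift ℤ] [F.IsTriangulated]
    (σ₀ : MassGrowth.StabilityCondition D) (hσ₀ : σ₀.IsAlgebraic)
    (σ : MassGrowth.StabilityCondition D) (hσ : σ ∈ connectedComponent σ₀) (t : ℝ) :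
    Tendsto (MassGrowth.entropySeq G F t) atTop (𝓝 (MassGrowth.entropy G F t)) ∧
      MassGrowth.entropy G F t = σ.massGrowth F t ∧
      Tendsto (σ.massSeq F t G) atTop (𝓝 (σ.massGrowth F t)) := by
  obtain ⟨L, hL⟩ := MassGrowth.exists_tendsto_entropySeq F hG t
  have hent : MassGrowth.entropy G F t = L := hL.limUnder_eq
  have hupper (E : D) : ∃ c : ℝ, ∀ n, σ.massSeq F t E n ≤
      ((c / n : ℝ) : EReal) + MassGrowth.entropySeq G F t n := by
    obtain ⟨C, hC, h⟩ := MassGrowth.StabilityCondition.exists_mass_le_complexity F σ hG t E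
    exact ⟨Real.log C, fun n => MassGrowth.log_div_le hC (h n) n⟩
  have hlower : ∃ c : ℝ, ∀ n, MassGrowth.entropySeq G F t n ≤
      ((c / n : ℝ) : EReal) + σ.massSeq F t G n := by
    obtain ⟨C, hC, h⟩ := hσ₀.exists_complexity_le_mass hG t
    obtain ⟨-, C', hC', h'⟩ :=
      MassGrowth.StabilityCondition.exists_mass_le_of_mem_connectedComponent hσ t
    refine ⟨Real.log (C * C'), fun n => MassGrowth.log_div_le (mul_pos hC hC') ?_ n⟩
    rw [← ENNReal.ofReal_mul (by positivity), mul_assoc]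
    exact (h _).trans (ENNReal.ofReal_le_ofReal (mul_le_mul_of_nonneg_left (h' _) hC.le))
  have hmass : Tendsto (σ.massSeq F t G) atTop (𝓝 L) := by
    obtain ⟨c, hc⟩ := hupper G
    obtain ⟨c', hc'⟩ := hlower
    refine tendsto_of_tendsto_of_tendsto_of_le_of_le (MassGrowth.tendsto_div_add (c := -c') hL)
      (MassGrowth.tendsto_div_add hL) (fun n => ?_) hc
    -- Adding the finite term `-c' / n` turns the lower bound into one for the mass sequence.
    have := add_le_add (le_refl (((-c' / n : ℝ) : EReal))) (hc' n)
    rwa [← add_assoc, ← EReal.coe_add, ← add_div, neg_add_cancel, zero_div, EReal.coe_zero,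
      zero_add] at this
  have hgrowth : σ.massGrowth F t = L := by
    refine le_antisymm (iSup_le fun E => ?_) ?_
    · obtain ⟨c, hc⟩ := hupper E
      exact (limsup_le_limsup (.of_forall hc)).trans_eq (MassGrowth.tendsto_div_add hL).limsup_eq
    -- The supremum over all objects is attained at `G`.
    · rw [← hmass.limsup_eq]
      exact le_iSup (fun E => limsup (σ.massSeq F t E) atTop) G
  rw [hent, hgrowth]
  exact ⟨hL, rfl, hmass⟩
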